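/- There is a universal constant $A>0$ such that both of the following hold. **(i) Concentration.** Let $\Lambda$ be a locally compact Polish space, $\lambda$ a positive Radon measure on $\Lambda$, and $K:\Lambda\times\Lambda\to\mathbb C$ a measurable kernel such that $K(y,x)=\overline{K(x,y)}$ and $\int K(x,y)K(y,z)\,d\lambda(y)=K(x,z)$ (absolutely convergent) for all $x,z\in\Lambda$, so that the associated integral operator on $L_2(\lambda)$ is a self-adjoint projection; assume that this operator has finite rank. Consider a determinantal point process on $\Lambda$ with kernel $K$ and reference measure $\lambda$, i.e. a random locally finite subset of $\Lambda$ whose $k$-point correlation functions with respect to $\lambda$ are $\det(K(x_i,x_j))_{i,j=1}^k$ for all $k$. Then the process has almost surely finitely many points, and for every bounded measurable $f:\Lambda\to\mathbb R$ the linear statistic $X_f=\sum_j f(x_j)$ (sum over the points of the process) is square integrable and satisfies, for every $\varepsilon>0$, $$ P(|X_f-\mathbb E X_f|\ge\varepsilon)\le \begin{cases} 2\exp\left(-\dfrac{\varepsilon^2}{4A\operatorname{Var}X_f}\right), & \text{if } \varepsilon<\dfrac{2A\operatorname{Var}X_f}{3\|f\|_\infty},\\[2ex] 2\exp\left(-\dfrac{\varepsilon}{6\|f\|_\infty}\right),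 & \text{if } \varepsilon\ge\dfrac{2A\operatorname{Var}X_f}{3\|f\|_\infty}, \end{cases} $$ where $\|f\|_\infty=\sup_{x\in\Lambda}|f(x)|$. (For $f\equiv 0$ the quotients by $\|f\|_\infty=0$ are read as $0$, and the bound is trivial.) **(ii) Fredholm determinants.** Let $K$ be a self-adjoint projection on a separable complex Hilbert space and let $h$ be a bounded operator such that $hK$ and $Kh$ are of trace class. Let $D=\{t\in\mathbb C: 3\|h\|\,|t|\le 1\}$. Then there is a continuous branch $t\mapsto\log\det(1+(e^{th}-1)K)$ on $D$ of the logarithm of the Fredholm determinant, with value $0$ at $t=0$, and for all $t\in D$ $$ \left|\log\det\bigl(1+(e^{th}-1)K\bigr)-t\operatorname{Tr}hK\right|\le\tfrac12A|t|^2\,\|[h,K]\|_2^2 , $$ where $\|h\|$ is the operator norm, $\|\cdot\|_2$ the Hilbert–Schmidt norm and $[h,K]=hK-Kh$. -/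

import Mathlib

open MeasureTheory ProbabilityTheory Filter Topology
open scoped ENNReal InnerProductSpace

universe u v w z

namespace DPP

/-! ### Point processes and determinantal point processes -/

section PointProcess

variable {Λ Ω : Type*} [MeasurableSpace Λ] [MeasurableSpace Ω]

/-- The bounded operator `T` on `L²(μ)` is the integral operator with kernel `K`. -/
def IsIntegralOperator (μ : Measure Λ) (K : Λ → Λ → ℂ)
    (T : Lp ℂ 2 μ →L[ℂ] Lp ℂ 2 μ) : Prop :=
  ∀ g : Lp ℂ 2 μ, T g =ᵐ[μ] fun x => ∫ y, K x y * g y ∂μ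

/-- `K` is a measurable kernel with `K(y,x) = conj K(x,y)` and
`∫ K(x,y) K(y,z) dμ(y) = K(x,z)` for all `x, z` (the integrals converging absolutely), whose
integral operator on `L²(μ)` is a self-adjoint projection of finite rank. -/
structure IsFiniteRankProjectionKernel (μ : Measure Λ) (K : Λ → Λ → ℂ) : Prop where
  measurable : Measurable (Function.uncurry K)
  hermitian : ∀ x y, K y x = starRingEnd ℂ (K x y)
  integrable : ∀ x z, Integrable (fun y => K x y * K y z) μ
  reproducing : ∀ x z, ∫ y, K x y * K y z ∂μ = K x z
  finiteRank : ∃ T : Lp ℂ 2 μ →L[ℂ] Lp ℂ 2 μ, IsIntegralOperator μ K T ∧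
    IsStarProjection T ∧ FiniteDimensional ℂ (LinearMap.range (T : Lp ℂ 2 μ →ₗ[ℂ] Lp ℂ 2 μ))

/-- `ξ` is a (simple) point process on `Λ`: a random subset of `Λ` with finitely many points in
every compact set, such that the number of points in every measurable set is a random variable. -/
structure IsPointProcess [TopologicalSpace Λ] (ξ : Ω → Set Λ) : Prop where
  locallyFinite : ∀ ω, ∀ C : Set Λ, IsCompact C → (ξ ω ∩ C).Finite
  measurable_count : ∀ B : Set Λ, MeasurableSet B → Measurable fun ω => (ξ ω ∩ B).encard

/-- Under `P`, the point process `ξ` is determinantal with kernel `K` and reference measure `μ`: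
for every `k` its `k`-point correlation function with respect to `μ` is
`ρ_k(x_1, …, x_k) = det (K(x_i, x_j))`, that is, for every measurable `g ≥ 0`,
`E ∑ g(x_1, …, x_k) = ∫ g ρ_k dμ^k`, where the sum is over all `k`-tuples of distinct points
of `ξ`. -/
structure IsDeterminantal [TopologicalSpace Λ] (P : Measure Ω) (ξ : Ω → Set Λ)
    (μ : Measure Λ) (K : Λ → Λ → ℂ) : Prop extends IsPointProcess ξ where
  correlation : ∀ (k : ℕ) (g : (Fin k → Λ) → ℝ≥0∞), Measurable g →
    ∫⁻ ω, ∑' x : Fin k ↪ ξ ω, g (fun i => (x i : Λ)) ∂P =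
      ∫⁻ x, g x * ENNReal.ofReal (Matrix.of fun i j => K (x i) (x j)).det.re
        ∂(Measure.pi fun _ : Fin k => μ)

/-- The linear statistic `X_f = ∑_{x ∈ ξ} f(x)`. -/
noncomputable def linearStatistic (ξ : Ω → Set Λ) (f : Λ → ℝ) (ω : Ω) : ℝ :=
  ∑' x : ξ ω, f x

/-- The supremum norm of a bounded real function. -/
noncomputable def supNorm (f : Λ → ℝ) : ℝ := ⨆ x, |f x|

end PointProcess

/-! ### Trace class operators, traces, Hilbert–Schmidt norms and Fredholm determinants -/

section TraceClass

variable {ι H : Type*} [NormedAddCommGroup H] [InnerProductSpace ℂ H]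

/-- `T` is of trace class (nuclear): `T = ∑ ⟨a_n, ·⟩ b_n` with `∑ ‖a_n‖ ‖b_n‖ < ∞`. -/
def IsTraceClass (T : H →L[ℂ] H) : Prop :=
  ∃ a b : ℕ → H, Summable (fun n => ‖a n‖ * ‖b n‖) ∧
    ∀ x, HasSum (fun n => ⟪a n, x⟫_ℂ • b n) (T x)

/-- The trace `∑_i ⟨e_i, T e_i⟩`, computed in an orthonormal basis `e`. -/
noncomputable def trace (e : HilbertBasis ι ℂ H) (T : H →L[ℂ] H) : ℂ :=
  ∑' i, ⟪e i, T (e i)⟫_ℂ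

/-- The Hilbert–Schmidt norm `(∑_i ‖T e_i‖²)^{1/2}`, computed in an orthonormal basis `e`. -/
noncomputable def hilbertSchmidtNorm (e : HilbertBasis ι ℂ H) (T : H →L[ℂ] H) : ℝ :=
  √(∑' i, ‖T (e i)‖ ^ 2)

/-- The finite section `(⟨e_i, T e_j⟩)_{i, j ∈ s}` of the matrix of `T` in the basis `e`. -/
noncomputable def finiteSection (e : HilbertBasis ι ℂ H) (T : H →L[ℂ] H) (s : Finset ι) :
    Matrix s s ℂ :=
  Matrix.of fun i j => ⟪e i, T (e j)⟫_ℂ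

open Classical in
/-- The Fredholm determinant `det(1 + T)` of a trace class operator `T`: the limit of the
determinants `det(1 + T_s)` of the finite sections of `1 + T` in an orthonormal basis, as the finite
index set `s` increases to the whole index set. -/
noncomputable def fredholmDet (e : HilbertBasis ι ℂ H) (T : H →L[ℂ] H) : ℂ :=
  limUnder atTop fun s : Finset ι => (1 + finiteSection e T s).det

end TraceClass

end DPP

namespace DPP

/-! ### Traces of nuclear operators and the Hilbert–Schmidt norm. -/

section HilbertSchmidt

variable {ι κ H : Type*} [NormedAddCommGroup H] [InnerProductSpace ℂ H]

/-! Both halves of the theorem rest on one estimate. Put `T(z) = (e^{zh} - 1)K` and `R = (1 +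
T(z))⁻¹`. If `3‖h‖|z| ≤ 1` then `‖T(z)‖ ≤ 1/2`, so `R` exists and `‖R‖ ≤ 2`. Formally the
logarithmic derivative of `det(1 + T(z))` is `tr(R e^{zh} hK)` (`resolventTrace` with `P = 1`), and
the logarithm is taken to be the integral of this trace along the segment from `0` to `t`;
continuity and the value at `0` then need no choice of branch. That its exponential is the Fredholm
determinant follows from Jacobi's formula on finite sections (`det_one_add_finiteSection`) and a
dominated limit (`fredholmDet_eq_exp`).

At `z = 0` the trace equals `tr hK`. Since `K R e^{zh} - K = K R [K, e^{zh}] (1 - K)` and `(1 - K) h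
K = (1 - K) [h, K]`, the deviation from this value is the trace of a product with two commutator
factors. Cauchy–Schwarz for Hilbert–Schmidt operators bounds it by `3|z| ‖[h, K]‖₂²`
(`norm_nuclear_sub_le`).

For the point process, a projection kernel of rank `N` produces almost surely exactly `N` points,
and Andréief's identity turns `E exp(t X_f)` into `det ⟨φ_i, e^{tf} φ_j⟩`, which is the Fredholm
determinant for `h` = multiplication by `f` (`fredholmDet_eq_det`). So the cumulant generating
function differs from its linear part by at most a constant times `t² ‖[f, K]‖₂²`. Its second
derivative at `0`, the variance, is `∑ ‖(1 - K) f φ_j‖²`, and four times this sum dominates `‖[f,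
K]‖₂²` (`hsSq_commutator_le`). Chernoff's bound (`chernoff_two_sided`) concludes. -/

theorem sum_norm_inner_mul_norm_inner_le {v : ι → H} (hv : Orthonormal ℂ v) (x y : H)
    (s : Finset ι) : ∑ i ∈ s, ‖⟪x, v i⟫_ℂ * ⟪v i, y⟫_ℂ‖ ≤ ‖x‖ * ‖y‖ := by
  simp_rw [norm_mul]
  refine (Real.sum_mul_le_sqrt_mul_sqrt _ _ _).trans ?_
  gcongr
  · refine Real.sqrt_le_iff.2 ⟨norm_nonneg _, ?_⟩
    simp_rw [norm_inner_symm x]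
    exact hv.sum_inner_products_le x
  · exact Real.sqrt_le_iff.2 ⟨norm_nonneg _, hv.sum_inner_products_le y⟩

/-- The trace of `X N` for a nuclear operator `N = ∑ ⟨a_n, ·⟩ b_n` is `∑ ⟨a_n, X b_n⟩`. -/
theorem hasSum_inner_mul_nuclear (e : HilbertBasis ι ℂ H) {a b : κ → H}
    (hab : Summable fun n => ‖a n‖ * ‖b n‖) {N : H →L[ℂ] H}
    (hN : ∀ x, HasSum (fun n => ⟪a n, x⟫_ℂ • b n) (N x)) (X : H →L[ℂ] H) :
    HasSum (fun i => ⟪e i, X (N (e i))⟫_ℂ) (∑' n, ⟪a n, X (b n)⟫_ℂ) := by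
  have hle := fun n => sum_norm_inner_mul_norm_inner_le e.orthonormal (a n) (X (b n))
  -- The double series converges absolutely: Bessel bounds the sum over the basis, nuclearity the
  -- sum over `n`. Parseval evaluates it in one order, the expansion of `N` in the other.
  have hsum : Summable fun p : κ × ι => ⟪a p.1, e p.2⟫_ℂ * ⟪e p.2, X (b p.1)⟫_ℂ := by
    rw [← summable_norm_iff]
    refine (summable_prod_of_nonneg fun _ => norm_nonneg _).2 ⟨fun n => ?_, ?_⟩
    · exact summable_of_sum_le (fun _ => norm_nonneg _) (hle n)
    · refine Summable.of_nonneg_of_le (fun n => tsum_nonneg fun _ => norm_nonneg _)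
        (fun n => Real.tsum_le_of_sum_le (fun _ => norm_nonneg _) (hle n)) ?_
      refine Summable.of_nonneg_of_le (fun n => by positivity) (fun n => ?_) (hab.mul_left ‖X‖)
      calc ‖a n‖ * ‖X (b n)‖ ≤ ‖a n‖ * (‖X‖ * ‖b n‖) := by gcongr; exact X.le_opNorm _
        _ = _ := by ring
  have h1 := hsum.hasSum.prod_fiberwise fun n => e.hasSum_inner_mul_inner (a n) (X (b n))
  rw [h1.tsum_eq]
  refine ((Equiv.prodComm ι κ).hasSum_iff.2 hsum.hasSum).prod_fiberwise fun i => ?_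
  have h2 := ((hN (e i)).mapL ((innerSL ℂ (e i)).comp X))
  simpa [inner_smul_right] using h2

/-- The square `∑ ‖X e_i‖²` of the Hilbert–Schmidt norm. -/
noncomputable def hsSq (e : HilbertBasis ι ℂ H) (X : H →L[ℂ] H) : ℝ≥0∞ := ∑' i, ‖X (e i)‖ₑ ^ 2

theorem hilbertSchmidtNorm_sq (e : HilbertBasis ι ℂ H) (X : H →L[ℂ] H) :
    hilbertSchmidtNorm e X ^ 2 = (hsSq e X).toReal := by
  rw [hilbertSchmidtNorm, Real.sq_sqrt (tsum_nonneg fun _ => by positivity), hsSq,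
    ENNReal.tsum_toReal_eq (by simp)]
  simp

theorem enorm_sq_eq_tsum (e : HilbertBasis ι ℂ H) (x : H) :
    ‖x‖ₑ ^ 2 = ∑' i, ‖⟪e i, x⟫_ℂ‖ₑ ^ 2 := by
  have h1 : HasSum (fun i => ‖⟪e i, x⟫_ℂ‖ ^ 2) (‖x‖ ^ 2) := by
    have h := (e.hasSum_inner_mul_inner x x).mapL Complex.reCLM
    convert h using 1
    · ext i
      rw [← inner_conj_symm x (e i), Complex.conj_mul']
      simp [← Complex.ofReal_pow]
    · simp [inner_self_eq_norm_sq_to_K, ← Complex.ofReal_pow]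
  have h2 : ∀ z : ℝ, 0 ≤ z → ENNReal.ofReal (z ^ 2) = ENNReal.ofReal z ^ 2 :=
    fun z hz => ENNReal.ofReal_pow hz 2
  simp_rw [← ofReal_norm, ← h2 _ (norm_nonneg _)]
  rw [← h1.tsum_eq, ENNReal.ofReal_tsum_of_nonneg (fun _ => by positivity) h1.summable]

theorem hsSq_mul_le (e : HilbertBasis ι ℂ H) (A X : H →L[ℂ] H) :
    hsSq e (A * X) ≤ ‖A‖ₑ ^ 2 * hsSq e X := by
  rw [hsSq, hsSq, ← ENNReal.tsum_mul_left]
  refine ENNReal.tsum_le_tsum fun i => ?_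
  rw [← mul_pow]
  gcongr
  exact A.le_opENorm _

theorem hsSq_sub_le (e : HilbertBasis ι ℂ H) (X Y : H →L[ℂ] H) :
    hsSq e (X - Y) ≤ 2 * hsSq e X + 2 * hsSq e Y := by
  simp only [hsSq, ← ENNReal.tsum_mul_left]
  rw [← ENNReal.tsum_add]
  refine ENNReal.tsum_le_tsum fun i => ?_
  have h2 : ∀ z : ℝ, 0 ≤ z → ENNReal.ofReal (z ^ 2) = ENNReal.ofReal z ^ 2 :=
    fun z hz => ENNReal.ofReal_pow hz 2
  simp_rw [← ofReal_norm, ← h2 _ (norm_nonneg _)]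
  rw [show (2 : ℝ≥0∞) = ENNReal.ofReal 2 by simp, ← ENNReal.ofReal_mul (by simp),
    ← ENNReal.ofReal_mul (by simp), ← ENNReal.ofReal_add (by positivity) (by positivity)]
  refine ENNReal.ofReal_le_ofReal ?_
  have h3 := norm_sub_le (X (e i)) (Y (e i))
  have h4 : ‖(X - Y) (e i)‖ ^ 2 ≤ (‖X (e i)‖ + ‖Y (e i)‖) ^ 2 := by
    gcongr; simpa using h3
  nlinarith [sq_nonneg (‖X (e i)‖ - ‖Y (e i)‖)]

theorem sum_norm_sq_le (e : HilbertBasis ι ℂ H) {X : H →L[ℂ] H} (hX : hsSq e X ≠ ⊤)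
    (s : Finset ι) : ∑ i ∈ s, ‖X (e i)‖ ^ 2 ≤ (hsSq e X).toReal := by
  have h := ENNReal.toReal_mono hX (ENNReal.sum_le_tsum (f := fun i => ‖X (e i)‖ₑ ^ 2) s)
  rw [ENNReal.toReal_sum (by simp)] at h
  simpa using h

variable [CompleteSpace H]

theorem hsSq_adjoint (e : HilbertBasis ι ℂ H) (X : H →L[ℂ] H) : hsSq e (star X) = hsSq e X := by
  simp only [hsSq, enorm_sq_eq_tsum e]
  rw [ENNReal.tsum_comm]
  refine tsum_congr fun i => tsum_congr fun j => ?_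
  rw [ContinuousLinearMap.star_eq_adjoint, ContinuousLinearMap.adjoint_inner_right,
    ← ofReal_norm, ← ofReal_norm, norm_inner_symm]

/-- `‖N e_i‖² = ⟨e_i, N* N e_i⟩`, so the sum is the trace of `X N` with `X = N*`, which converges
because `N` is nuclear. -/
theorem hsSq_nuclear_ne_top (e : HilbertBasis ι ℂ H) {a b : κ → H}
    (hab : Summable fun n => ‖a n‖ * ‖b n‖) {N : H →L[ℂ] H}
    (hN : ∀ x, HasSum (fun n => ⟪a n, x⟫_ℂ • b n) (N x)) : hsSq e N ≠ ⊤ := by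
  have h := ((hasSum_inner_mul_nuclear e hab hN (star N)).mapL Complex.reCLM).summable
  have h2 : (fun i => Complex.reCLM ⟪e i, (star N) (N (e i))⟫_ℂ) = fun i => ‖N (e i)‖ ^ 2 := by
    ext i
    rw [ContinuousLinearMap.star_eq_adjoint, ContinuousLinearMap.adjoint_inner_right,
      inner_self_eq_norm_sq_to_K]
    simp [← Complex.ofReal_pow]
  rw [h2] at h
  have h3 := h.tsum_ofReal_ne_top
  convert h3 using 2
  rw [hsSq]
  refine tsum_congr fun i => ?_
  rw [ENNReal.ofReal_pow (norm_nonneg _), ofReal_norm]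

/-- Cauchy–Schwarz for the trace of a product containing two Hilbert–Schmidt factors. -/
theorem norm_tsum_inner_mul_le (e : HilbertBasis ι ℂ H) (A B C D : H →L[ℂ] H) (S : ℝ≥0∞)
    (hS : S ≠ ⊤) (hC : hsSq e C ≤ S) (hD : hsSq e D ≤ S) :
    ‖∑' i, ⟪e i, (A * C * B * D) (e i)⟫_ℂ‖ ≤ ‖A‖ * ‖B‖ * S.toReal := by
  have h1 : hsSq e (star (A * C)) ≤ ‖A‖ₑ ^ 2 * S := by
    rw [hsSq_adjoint]
    exact (hsSq_mul_le e A C).trans (by gcongr)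
  have h2 : hsSq e (B * D) ≤ ‖B‖ₑ ^ 2 * S := (hsSq_mul_le e B D).trans (by gcongr)
  have hA : ‖A‖ₑ ^ 2 * S ≠ ⊤ := ENNReal.mul_ne_top (by simp) hS
  have hB : ‖B‖ₑ ^ 2 * S ≠ ⊤ := ENNReal.mul_ne_top (by simp) hS
  have key : ∀ s : Finset ι, ∑ i ∈ s, ‖⟪e i, (A * C * B * D) (e i)⟫_ℂ‖
      ≤ ‖A‖ * ‖B‖ * S.toReal := by
    intro s
    calc ∑ i ∈ s, ‖⟪e i, (A * C * B * D) (e i)⟫_ℂ‖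
        ≤ ∑ i ∈ s, ‖(star (A * C)) (e i)‖ * ‖(B * D) (e i)‖ := by
          refine Finset.sum_le_sum fun i _ => ?_
          rw [mul_assoc, mul_apply_eq_comp (A * C),
            ← ContinuousLinearMap.adjoint_inner_left, ContinuousLinearMap.star_eq_adjoint]
          exact norm_inner_le_norm _ _
      _ ≤ √(∑ i ∈ s, ‖(star (A * C)) (e i)‖ ^ 2) * √(∑ i ∈ s, ‖(B * D) (e i)‖ ^ 2) :=
          Real.sum_mul_le_sqrt_mul_sqrt _ _ _
      _ ≤ √(‖A‖ ^ 2 * S.toReal) * √(‖B‖ ^ 2 * S.toReal) := by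
          gcongr
          · refine (sum_norm_sq_le e (ne_top_of_le_ne_top hA h1) s).trans ?_
            simpa using ENNReal.toReal_mono hA h1
          · refine (sum_norm_sq_le e (ne_top_of_le_ne_top hB h2) s).trans ?_
            simpa using ENNReal.toReal_mono hB h2
      _ = _ := by
          rw [Real.sqrt_mul (by positivity), Real.sqrt_mul (by positivity),
            Real.sqrt_sq (norm_nonneg _), Real.sqrt_sq (norm_nonneg _)]
          have := Real.mul_self_sqrt (ENNReal.toReal_nonneg (a := S))
          linear_combination ‖A‖ * ‖B‖ * this
  have hs : Summable fun i => ‖⟪e i, (A * C * B * D) (e i)⟫_ℂ‖ :=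
    summable_of_sum_le (fun _ => norm_nonneg _) key
  exact (norm_tsum_le_tsum_norm hs).trans (Real.tsum_le_of_sum_le (fun _ => norm_nonneg _) key)

end HilbertSchmidt

/-! ### Norm bounds for `(1 + x)⁻¹` and `e^x - 1`. -/

section BanachAlgebra

variable {R : Type*} [NormedRing R] [CompleteSpace R]

theorem isUnit_one_add_of_norm_le {x : R} (hx : ‖x‖ ≤ 1 / 2) : IsUnit (1 + x) := by
  have := isUnit_one_sub_of_norm_lt_one (x := -x) (by rw [norm_neg]; linarith)
  simpa using this

/-- From `R = 1 - R x` one gets `‖R‖ ≤ 1 + ‖R‖/2`. The norm of `1` is only assumed to be at most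
`1`, so that operators on the zero space are covered. -/
theorem norm_inverse_one_add_le (h1 : ‖(1 : R)‖ ≤ 1) {x : R} (hx : ‖x‖ ≤ 1 / 2) :
    ‖Ring.inverse (1 + x)‖ ≤ 2 := by
  have h := Ring.inverse_mul_cancel _ (isUnit_one_add_of_norm_le hx)
  have h2 : Ring.inverse (1 + x) = 1 - Ring.inverse (1 + x) * x := by
    rw [mul_add, mul_one] at h; exact eq_sub_of_add_eq h
  have h3 : ‖Ring.inverse (1 + x)‖ ≤ 1 + ‖Ring.inverse (1 + x)‖ * (1 / 2) := by
    conv_lhs => rw [h2]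
    refine (norm_sub_le _ _).trans (add_le_add h1 ((norm_mul_le _ _).trans ?_))
    gcongr
  linarith

variable [NormedAlgebra ℂ R]

theorem norm_exp_sub_one_le (x : R) : ‖NormedSpace.exp x - 1‖ ≤ Real.exp ‖x‖ - 1 := by
  have h := (hasSum_nat_add_iff' 1).2 (NormedSpace.exp_series_hasSum_exp' (𝕂 := ℂ) x)
  have h2 := (hasSum_nat_add_iff' 1).2 (NormedSpace.exp_series_hasSum_exp' (𝕂 := ℝ) ‖x‖)
  rw [← Real.exp_eq_exp_ℝ] at h2
  simp only [Finset.range_one, Finset.sum_singleton, Nat.factorial_zero, Nat.cast_one, inv_one,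
    pow_zero, one_smul] at h h2
  rw [← h.tsum_eq]
  refine tsum_of_norm_bounded h2 fun n => ?_
  rw [norm_smul, smul_eq_mul]
  gcongr
  · simp
  · exact norm_pow_le' x (Nat.succ_pos n)

theorem exp_third_le : Real.exp (1 / 3) ≤ 3 / 2 := by
  have h : Real.exp (1 / 3) ^ 3 = Real.exp 1 := by rw [← Real.exp_nat_mul]; norm_num
  have := Real.exp_one_lt_d9
  by_contra! hc
  have : (3 / 2 : ℝ) ^ 3 < Real.exp (1 / 3) ^ 3 := by gcongr
  linarith

/-- This is where the radius `1/(3‖h‖)` comes from: `e < 27/8` gives `e^{1/3} - 1 ≤ 1/2`, which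
keeps `1 + (e^{zh} - 1)K` uniformly invertible. -/
theorem norm_exp_smul_sub_one_le {x : R} {z : ℂ} (hz : 3 * ‖x‖ * ‖z‖ ≤ 1) :
    ‖NormedSpace.exp (z • x) - 1‖ ≤ 1 / 2 := by
  have h : ‖z • x‖ ≤ 1 / 3 := by rw [norm_smul]; linarith
  linarith [norm_exp_sub_one_le (z • x), Real.exp_le_exp.2 h, exp_third_le]

end BanachAlgebra

/-! ### The trace functional `X ↦ tr(X hK)` and the commutator estimate. -/

section Core

variable {ι κ H : Type*} [NormedAddCommGroup H] [InnerProductSpace ℂ H]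

/-- The functional `X ↦ ∑ ⟨a_n, X b_n⟩` on bounded operators. -/
noncomputable def nuclearFunctional (a b : κ → H) (hab : Summable fun n => ‖a n‖ * ‖b n‖) :
    (H →L[ℂ] H) →L[ℂ] ℂ :=
  have hs : ∀ X : H →L[ℂ] H, ∀ n, ‖⟪a n, X (b n)⟫_ℂ‖ ≤ ‖X‖ * (‖a n‖ * ‖b n‖) := fun X n =>
    calc ‖⟪a n, X (b n)⟫_ℂ‖ ≤ ‖a n‖ * ‖X (b n)‖ := norm_inner_le_norm _ _
      _ ≤ ‖a n‖ * (‖X‖ * ‖b n‖) := by gcongr; exact X.le_opNorm _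
      _ = _ := by ring
  have hS : ∀ X : H →L[ℂ] H, Summable fun n => ⟪a n, X (b n)⟫_ℂ := fun X =>
    Summable.of_norm_bounded (hab.mul_left ‖X‖) (hs X)
  LinearMap.mkContinuous
    { toFun := fun X => ∑' n, ⟪a n, X (b n)⟫_ℂ
      map_add' := fun X Y => by
        simp only [add_apply, inner_add_right]
        exact (hS X).tsum_add (hS Y)
      map_smul' := fun c X => by
        simp only [smul_apply, inner_smul_right, RingHom.id_apply, smul_eq_mul]
        exact tsum_mul_left }
    (∑' n, ‖a n‖ * ‖b n‖) fun X => by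
      rw [mul_comm]
      exact tsum_of_norm_bounded (hab.hasSum.mul_left ‖X‖) (hs X)

theorem nuclearFunctional_apply (a b : κ → H) (hab : Summable fun n => ‖a n‖ * ‖b n‖)
    (X : H →L[ℂ] H) : nuclearFunctional a b hab X = ∑' n, ⟪a n, X (b n)⟫_ℂ := rfl

theorem norm_one_le : ‖(1 : H →L[ℂ] H)‖ ≤ 1 := ContinuousLinearMap.norm_id_le

variable [CompleteSpace H]

theorem norm_expDefect_le {K h : H →L[ℂ] H} (hK : ‖K‖ ≤ 1) {z : ℂ} (hz : 3 * ‖h‖ * ‖z‖ ≤ 1) :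
    ‖(NormedSpace.exp (z • h) - 1) * K‖ ≤ 1 / 2 :=
  calc ‖(NormedSpace.exp (z • h) - 1) * K‖ ≤ ‖NormedSpace.exp (z • h) - 1‖ * ‖K‖ := norm_mul_le _ _
    _ ≤ 1 / 2 * 1 := by gcongr; exact norm_exp_smul_sub_one_le hz
    _ = 1 / 2 := mul_one _

/-- The functional is `X ↦ tr(X hK)`. The trailing `1 - K` meets `hK` and produces `(1 - K)[h, K]`,
a second Hilbert–Schmidt factor besides `[K, h]`; this settles the first power. Higher powers follow
from the Leibniz rule `[K, h^{m+2}] = [K, h^{m+1}] h + h^{m+1} [K, h]`, whose `m + 1` accumulated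
terms give the factor `m + 1`. -/
theorem norm_nuclear_commutator_le (e : HilbertBasis ι ℂ H) {a b : κ → H}
    (hab : Summable fun n => ‖a n‖ * ‖b n‖) {K h : H →L[ℂ] H} (hK : IsStarProjection K)
    (hN : ∀ x, HasSum (fun n => ⟪a n, x⟫_ℂ • b n) ((h * K) x))
    (hS : hsSq e (h * K - K * h) ≠ ⊤) (m : ℕ) (A B : H →L[ℂ] H) :
    ‖nuclearFunctional a b hab (A * (K * h ^ (m + 1) - h ^ (m + 1) * K) * B * (1 - K))‖ ≤
      ‖A‖ * ‖B‖ * ((m + 1) * ‖h‖ ^ m) * (hsSq e (h * K - K * h)).toReal := by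
  have base : ∀ A B : H →L[ℂ] H,
      ‖nuclearFunctional a b hab (A * (K * h - h * K) * B * (1 - K))‖ ≤
        ‖A‖ * ‖B‖ * (hsSq e (h * K - K * h)).toReal := by
    intro A B
    have h1 := (hasSum_inner_mul_nuclear e hab hN (A * (K * h - h * K) * B * (1 - K))).tsum_eq
    rw [nuclearFunctional_apply, ← h1]
    have h2 : ∀ x, (A * (K * h - h * K) * B * (1 - K)) ((h * K) x) =
        (A * (K * h - h * K) * B * ((1 - K) * (h * K - K * h))) x := by
      intro x
      have h3 : (1 - K) * (h * K - K * h) = (1 - K) * (h * K) := by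
        rw [mul_sub, ← mul_assoc (1 - K) K, hK.one_sub_mul_self, zero_mul, sub_zero]
      rw [h3, ← mul_assoc _ (1 - K)]
      rfl
    simp_rw [h2]
    refine norm_tsum_inner_mul_le e A B _ _ _ hS ?_ ?_
    · simp only [hsSq]
      refine le_of_eq (tsum_congr fun i => ?_)
      rw [← neg_sub, neg_apply, enorm_neg]
    · refine (hsSq_mul_le e _ _).trans ?_
      have : ‖(1 - K)‖ₑ ≤ 1 := by
        rw [← ofReal_norm]
        simpa using ENNReal.ofReal_le_ofReal hK.one_sub.norm_le
      calc _ ≤ 1 ^ 2 * hsSq e (h * K - K * h) := by gcongr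
        _ = _ := by simp
  induction m generalizing A B with
  | zero => simpa using base A B
  | succ m ih =>
    have h1 : A * (K * h ^ (m + 1 + 1) - h ^ (m + 1 + 1) * K) * B * (1 - K) =
        A * (K * h ^ (m + 1) - h ^ (m + 1) * K) * (h * B) * (1 - K) +
          (A * h ^ (m + 1)) * (K * h - h * K) * B * (1 - K) := by
      rw [pow_succ h (m + 1)]; noncomm_ring
    rw [h1, map_add]
    refine (norm_add_le _ _).trans ?_
    refine (add_le_add (ih A (h * B)) (base (A * h ^ (m + 1)) B)).trans ?_
    have h2 : ‖h * B‖ ≤ ‖h‖ * ‖B‖ := norm_mul_le _ _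
    have h3 : ‖A * h ^ (m + 1)‖ ≤ ‖A‖ * ‖h‖ ^ (m + 1) :=
      (norm_mul_le _ _).trans (by gcongr; exact norm_pow_le' _ (Nat.succ_pos m))
    have h4 := ENNReal.toReal_nonneg (a := hsSq e (h * K - K * h))
    calc _ ≤ ‖A‖ * (‖h‖ * ‖B‖) * ((m + 1) * ‖h‖ ^ m) * (hsSq e (h * K - K * h)).toReal +
          ‖A‖ * ‖h‖ ^ (m + 1) * ‖B‖ * (hsSq e (h * K - K * h)).toReal := by gcongr
      _ = _ := by push_cast; ring

theorem norm_nuclear_sub_le (e : HilbertBasis ι ℂ H) {a b : κ → H}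
    (hab : Summable fun n => ‖a n‖ * ‖b n‖) {K h : H →L[ℂ] H} (hK : IsStarProjection K)
    (hN : ∀ x, HasSum (fun n => ⟪a n, x⟫_ℂ • b n) ((h * K) x)) (haK : ∀ n, K (a n) = a n)
    (hS : hsSq e (h * K - K * h) ≠ ⊤) {z : ℂ} (hz : 3 * ‖h‖ * ‖z‖ ≤ 1) :
    ‖nuclearFunctional a b hab (Ring.inverse (1 + (NormedSpace.exp (z • h) - 1) * K) *
        NormedSpace.exp (z • h)) - nuclearFunctional a b hab 1‖ ≤
      3 * ‖z‖ * (hsSq e (h * K - K * h)).toReal := by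
  set E := NormedSpace.exp (z • h) with hE
  have hT := norm_expDefect_le hK.norm_le hz
  set R := Ring.inverse (1 + (E - 1) * K) with hR
  have hRW : R * (1 + (E - 1) * K) = 1 :=
    Ring.inverse_mul_cancel _ (isUnit_one_add_of_norm_le hT)
  have hRn : ‖R‖ ≤ 2 := norm_inverse_one_add_le norm_one_le hT
  have hKK : K * K = K := hK.isIdempotentElem
  -- Since the `a n` lie in the range of `K`, a factor `K` may be inserted on the left for free;
  -- this is what makes the algebraic identity `hid` applicable.
  have hKτ : ∀ X : H →L[ℂ] H,
      nuclearFunctional a b hab (K * X) = nuclearFunctional a b hab X := by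
    intro X
    simp only [nuclearFunctional_apply]
    refine tsum_congr fun n => ?_
    have := ContinuousLinearMap.adjoint_inner_left K (X (b n)) (a n)
    rw [← ContinuousLinearMap.star_eq_adjoint, hK.isSelfAdjoint.star_eq, haK n] at this
    exact this.symm
  -- With respect to `K` and `1 - K`, the operator `1 + (E - 1)K` acts as `E` on the range of `K`
  -- and as the identity on the range of `1 - K`; the next three facts express this for its inverse.
  have hREK : R * E * K = K := by
    calc R * E * K = R * (1 + (E - 1) * K) * K := by
          rw [mul_assoc, mul_assoc]; congr 1
          rw [add_mul, mul_assoc _ K K, hKK]; noncomm_ring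
      _ = K := by rw [hRW, one_mul]
  have hRQ : R * (1 - K) = 1 - K := by
    calc R * (1 - K) = R * (1 + (E - 1) * K) * (1 - K) := by
          rw [mul_assoc]; congr 1
          rw [add_mul, mul_assoc _ K, hK.mul_one_sub_self]; noncomm_ring
      _ = 1 - K := by rw [hRW, one_mul]
  have hKRK : K * R = K * R * K := by
    have : K * R * (1 - K) = 0 := by rw [mul_assoc, hRQ, hK.mul_one_sub_self]
    rw [mul_sub, mul_one, sub_eq_zero] at this
    exact this
  have hid : K * (R * E) - K * 1 = K * R * (K * E - E * K) * 1 * (1 - K) := by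
    calc K * (R * E) - K * 1 = K * R * E - K * (R * E * K) := by
          rw [hREK, hKK]; noncomm_ring
      _ = K * R * E * (1 - K) := by noncomm_ring
      _ = K * R * K * E * (1 - K) := by rw [← hKRK]
      _ = K * R * (K * E - E * K) * 1 * (1 - K) + K * R * E * (K * (1 - K)) := by noncomm_ring
      _ = _ := by rw [hK.mul_one_sub_self, mul_zero, add_zero]
  have h2 := (nuclearFunctional a b hab).map_sub (R * E) 1
  rw [← h2, ← hKτ, mul_sub, hid]
  -- `Ψ` packages `X ↦ K R [K, X] (1 - K)` as a continuous linear map, so that `e^{zh}` can be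
  -- expanded in its power series; the constant term drops out because `[K, 1] = 0`.
  let Ψ : (H →L[ℂ] H) →L[ℂ] (H →L[ℂ] H) :=
    ((ContinuousLinearMap.mul ℂ (H →L[ℂ] H)).flip (1 - K)).comp
      ((ContinuousLinearMap.mul ℂ (H →L[ℂ] H) (K * R)).comp
        (ContinuousLinearMap.mul ℂ (H →L[ℂ] H) K - (ContinuousLinearMap.mul ℂ (H →L[ℂ] H)).flip K))
  have hΨ : ∀ X, Ψ X = K * R * (K * X - X * K) * 1 * (1 - K) := by
    intro X; simp [Ψ]; noncomm_ring
  rw [← hΨ]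
  have hsum := (NormedSpace.exp_series_hasSum_exp' (𝕂 := ℂ) (z • h)).mapL
    ((nuclearFunctional a b hab).comp Ψ)
  rw [← hE] at hsum
  have h0 : Ψ 1 = 0 := by rw [hΨ]; simp
  have hsum1 := (hasSum_nat_add_iff' 1).2 hsum
  simp only [Finset.range_one, Finset.sum_singleton, Nat.factorial_zero, Nat.cast_one, inv_one,
    pow_zero, one_smul, ContinuousLinearMap.comp_apply, h0, map_zero, sub_zero] at hsum1
  rw [← hsum1.tsum_eq]
  set S := (hsSq e (h * K - K * h)).toReal with hSdef
  have hS0 : 0 ≤ S := ENNReal.toReal_nonneg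
  -- The factor `n + 1` of the commutator bound cancels against `(n + 1)!`, leaving the exponential
  -- series times `2|z|S`, where `2` bounds `‖K R‖`. Then `2 e^{1/3} ≤ 3` gives the constant.
  have hexp := (NormedSpace.exp_series_hasSum_exp' (𝕂 := ℝ) (‖z‖ * ‖h‖)).mul_left (2 * ‖z‖ * S)
  rw [← Real.exp_eq_exp_ℝ] at hexp
  refine (tsum_of_norm_bounded hexp fun n => ?_).trans ?_
  · rw [smul_pow, map_smul, map_smul, map_smul, map_smul, hΨ, norm_smul, norm_smul, norm_pow,
      norm_inv]
    have hKR : ‖K * R‖ ≤ 2 := (norm_mul_le _ _).trans (by nlinarith [hK.norm_le, norm_nonneg R])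
    have h4 := norm_nuclear_commutator_le e hab hK hN hS n (K * R) 1
    calc _ ≤ ‖((n + 1).factorial : ℂ)‖⁻¹ * (‖z‖ ^ (n + 1) *
          (‖K * R‖ * ‖(1 : H →L[ℂ] H)‖ * ((n + 1) * ‖h‖ ^ n) * S)) := by gcongr
      _ ≤ ‖((n + 1).factorial : ℂ)‖⁻¹ * (‖z‖ ^ (n + 1) * (2 * 1 * ((n + 1) * ‖h‖ ^ n) * S)) := by
          gcongr; exact norm_one_le
      _ = _ := by
          rw [Complex.norm_natCast, Nat.factorial_succ, smul_eq_mul]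
          have := Nat.factorial_pos n
          push_cast
          field_simp
          ring
  · have : Real.exp (‖z‖ * ‖h‖) ≤ 3 / 2 :=
      (Real.exp_le_exp.2 (by linarith)).trans exp_third_le
    calc 2 * ‖z‖ * S * Real.exp (‖z‖ * ‖h‖) ≤ 2 * ‖z‖ * S * (3 / 2) := by gcongr
      _ = _ := by ring

end Core

/-! ### Jacobi's formula and a scalar linear differential equation. -/

section Jacobi

/-- Jacobi's formula for the derivative of a determinant. -/
theorem hasDerivAt_det {n : Type*} [Fintype n] [DecidableEq n] {M : ℝ → Matrix n n ℂ}
    {M' : Matrix n n ℂ} {u : ℝ} (h : ∀ i j, HasDerivAt (fun u => M u i j) (M' i j) u) :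
    HasDerivAt (fun u => (M u).det) (((M u).adjugate * M').trace) u := by
  have h1 : HasDerivAt (fun u => ∑ σ : Equiv.Perm n, Equiv.Perm.sign σ • ∏ i, M u (σ i) i)
      (∑ σ : Equiv.Perm n, Equiv.Perm.sign σ •
        ∑ i, (∏ j ∈ Finset.univ.erase i, M u (σ j) j) • M' (σ i) i) u :=
    HasDerivAt.fun_sum fun σ _ =>
      (HasDerivAt.fun_finsetProd fun i _ => h (σ i) i).const_smul (Equiv.Perm.sign σ)
  simp_rw [Matrix.det_apply]
  convert h1 using 1
  simp_rw [Finset.smul_sum]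
  rw [Finset.sum_comm, Matrix.trace]
  refine Finset.sum_congr rfl fun i _ => ?_
  have h2 : ((M u).adjugate * M').diag i = (M u).cramer (fun k => M' k i) i := by
    rw [Matrix.cramer_eq_adjugate_mulVec]; rfl
  rw [h2, Matrix.cramer_apply, Matrix.det_apply]
  refine Finset.sum_congr rfl fun σ _ => ?_
  congr 1
  rw [← Finset.mul_prod_erase Finset.univ _ (Finset.mem_univ i), smul_eq_mul, mul_comm]
  congr 1
  · refine Finset.prod_congr rfl fun j hj => ?_
    rw [Matrix.updateCol_ne (Finset.ne_of_mem_erase hj)]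
  · rw [Matrix.updateCol_self]

/-- The solution of a scalar linear differential equation on `[0, 1]`. -/
theorem eq_mul_exp_integral {F ψ : ℝ → ℂ} (hψ : ContinuousOn ψ (Set.Icc 0 1))
    (hF : ∀ u ∈ Set.Icc (0 : ℝ) 1, HasDerivAt F (F u * ψ u) u) :
    F 1 = F 0 * Complex.exp (∫ u in (0 : ℝ)..1, ψ u) := by
  -- Extending `ψ` by constants outside `[0, 1]` makes it continuous on the line, so its primitive
  -- has a two-sided derivative at the endpoints too.
  set χ : ℝ → ℂ := Set.IccExtend zero_le_one (Set.domRestrict (Set.Icc (0 : ℝ) 1) ψ) with hχ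
  have hχc : Continuous χ := (continuousOn_iff_continuous_domRestrict.1 hψ).Icc_extend'
  have hχe : ∀ u ∈ Set.Icc (0 : ℝ) 1, χ u = ψ u := fun u hu => by
    rw [hχ, Set.IccExtend_of_mem _ _ hu]; rfl
  have hG : ∀ u, HasDerivAt (fun u => ∫ x in (0 : ℝ)..u, χ x) (χ u) u := fun u =>
    intervalIntegral.integral_hasDerivAt_right (hχc.intervalIntegrable _ _)
      (hχc.stronglyMeasurableAtFilter _ _) hχc.continuousAt
  set g : ℝ → ℂ := fun u => F u * Complex.exp (-∫ x in (0 : ℝ)..u, χ x) with hg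
  have hgd : ∀ u ∈ Set.Icc (0 : ℝ) 1, HasDerivAt g 0 u := by
    intro u hu
    refine ((hF u hu).mul (hG u).neg.cexp).congr_deriv ?_
    rw [hχe u hu]; ring
  have hconst : g 1 = g 0 :=
    constant_of_has_deriv_right_zero (fun u hu => (hgd u hu).continuousAt.continuousWithinAt)
      (fun u hu => (hgd u ⟨hu.1, hu.2.le⟩).hasDerivWithinAt) 1 (by simp)
  have hint : ∫ x in (0 : ℝ)..1, χ x = ∫ x in (0 : ℝ)..1, ψ x :=
    intervalIntegral.integral_congr fun u hu => hχe u (by simpa using hu)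
  simp only [hg, hint, intervalIntegral.integral_same, neg_zero, Complex.exp_zero, mul_one]
    at hconst
  rw [← hconst, mul_assoc, ← Complex.exp_add]
  simp

end Jacobi

/-! ### Finite sections and compressions by basis projections. -/

section FiniteSection

variable {ι κ H : Type*} [NormedAddCommGroup H] [InnerProductSpace ℂ H]

/-- The orthogonal projection onto the span of the basis vectors indexed by `s`. -/
noncomputable def basisProj (e : HilbertBasis ι ℂ H) (s : Finset ι) : H →L[ℂ] H :=
  ∑ i ∈ s, (innerSL ℂ (e i)).smulRight (e i)

theorem basisProj_apply (e : HilbertBasis ι ℂ H) (s : Finset ι) (x : H) :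
    basisProj e s x = ∑ i ∈ s, ⟪e i, x⟫_ℂ • e i := by
  simp [basisProj]

theorem basisProj_basis (e : HilbertBasis ι ℂ H) {s : Finset ι} {i : ι} (hi : i ∈ s) :
    basisProj e s (e i) = e i := by
  classical
  rw [basisProj_apply]
  simp_rw [orthonormal_iff_ite.1 e.orthonormal]
  simp [hi]

theorem tendsto_basisProj (e : HilbertBasis ι ℂ H) (x : H) :
    Tendsto (fun s => basisProj e s x) atTop (𝓝 x) := by
  simp_rw [basisProj_apply]
  have := e.hasSum_repr x
  simp_rw [e.repr_apply_apply] at this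
  exact this

theorem inner_basisProj_left (e : HilbertBasis ι ℂ H) (s : Finset ι) (x y : H) :
    ⟪basisProj e s x, y⟫_ℂ = ∑ i ∈ s, ⟪x, e i⟫_ℂ * ⟪e i, y⟫_ℂ := by
  simp [basisProj_apply, mul_comm]

theorem inner_basisProj_right (e : HilbertBasis ι ℂ H) (s : Finset ι) (x y : H) :
    ⟪x, basisProj e s y⟫_ℂ = ∑ i ∈ s, ⟪x, e i⟫_ℂ * ⟪e i, y⟫_ℂ := by
  simp [basisProj_apply, mul_comm]

theorem finiteSection_mul (e : HilbertBasis ι ℂ H) (X Y : H →L[ℂ] H) (s : Finset ι) :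
    finiteSection e X s * finiteSection e Y s = finiteSection e (X * basisProj e s * Y) s := by
  ext i j
  simp only [Matrix.mul_apply, finiteSection, Matrix.of_apply, mul_apply_eq_comp,
    basisProj_apply, map_sum, map_smul, inner_sum, inner_smul_right]
  exact (Finset.sum_coe_sort s fun k => ⟪e i, X (e k)⟫_ℂ * ⟪e k, Y (e j)⟫_ℂ).trans
    (Finset.sum_congr rfl fun k _ => mul_comm _ _)

theorem finiteSection_add (e : HilbertBasis ι ℂ H) (X Y : H →L[ℂ] H) (s : Finset ι) :
    finiteSection e (X + Y) s = finiteSection e X s + finiteSection e Y s := by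
  ext i j
  simp [finiteSection]

theorem finiteSection_one [DecidableEq ι] (e : HilbertBasis ι ℂ H) (s : Finset ι) :
    finiteSection e 1 s = 1 := by
  ext i j
  simp [finiteSection, Matrix.one_apply, orthonormal_iff_ite.1 e.orthonormal]

theorem finiteSection_mul_basisProj (e : HilbertBasis ι ℂ H) (X : H →L[ℂ] H) (s : Finset ι) :
    finiteSection e (X * basisProj e s) s = finiteSection e X s := by
  ext i j
  simp [finiteSection, basisProj_basis e j.2]

variable [CompleteSpace H]

theorem isStarProjection_basisProj (e : HilbertBasis ι ℂ H) (s : Finset ι) :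
    IsStarProjection (basisProj e s) where
  isIdempotentElem := by
    ext x
    rw [mul_apply_eq_comp, basisProj_apply e s x, map_sum]
    refine Finset.sum_congr rfl fun i hi => ?_
    rw [map_smul, basisProj_basis e hi]
  isSelfAdjoint := by
    rw [ContinuousLinearMap.isSelfAdjoint_iff_isSymmetric]
    intro x y
    simp [inner_basisProj_left, inner_basisProj_right]

theorem finiteSection_basisProj_mul (e : HilbertBasis ι ℂ H) (X : H →L[ℂ] H) (s : Finset ι) :
    finiteSection e (basisProj e s * X) s = finiteSection e X s := by
  ext i j
  have h := ContinuousLinearMap.adjoint_inner_left (basisProj e s) (X (e j)) (e i)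
  rw [← ContinuousLinearMap.star_eq_adjoint,
    (isStarProjection_basisProj e s).isSelfAdjoint.star_eq, basisProj_basis e i.2] at h
  simpa [finiteSection] using h.symm

/-- The inverse of `1 + T_s` for a finite section `T_s` of `T`. -/
theorem one_add_finiteSection_mul [DecidableEq ι] (e : HilbertBasis ι ℂ H) {T : H →L[ℂ] H}
    (s : Finset ι) (hT : IsUnit (1 + basisProj e s * T * basisProj e s)) :
    (1 + finiteSection e T s) *
      finiteSection e (Ring.inverse (1 + basisProj e s * T * basisProj e s)) s = 1 := by
  set P := basisProj e s with hP
  set R := Ring.inverse (1 + P * T * P) with hR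
  have hPP : P * P = P := (isStarProjection_basisProj e s).isIdempotentElem
  have hWR : (1 + P * T * P) * R = 1 := Ring.mul_inverse_cancel _ hT
  have hRW : R * (1 + P * T * P) = 1 := Ring.inverse_mul_cancel _ hT
  -- `P` commutes with `1 + P T P`, hence with its inverse; therefore the section of the inverse is
  -- the inverse of the section.
  have hcomm : (1 + P * T * P) * P = P * (1 + P * T * P) := by
    calc (1 + P * T * P) * P = P + P * T * (P * P) := by noncomm_ring
      _ = P + (P * P) * T * P := by rw [hPP]
      _ = _ := by noncomm_ring
  have hPR : P * R = R * P := by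
    calc P * R = R * (1 + P * T * P) * P * R := by rw [hRW, one_mul]
      _ = R * ((1 + P * T * P) * P) * R := by noncomm_ring
      _ = R * P * ((1 + P * T * P) * R) := by rw [hcomm]; noncomm_ring
      _ = R * P := by rw [hWR, mul_one]
  have h1 : 1 + finiteSection e T s = finiteSection e (1 + P * T * P) s := by
    rw [finiteSection_add, finiteSection_one, finiteSection_mul_basisProj,
      finiteSection_basisProj_mul]
  rw [h1, finiteSection_mul, mul_assoc, ← hP, hPR, ← mul_assoc, hWR, finiteSection_mul_basisProj,
    finiteSection_one]

theorem adjugate_eq_det_smul {n : Type*} [Fintype n] [DecidableEq n] {M N : Matrix n n ℂ}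
    (h : M * N = 1) : M.adjugate = M.det • N := by
  calc M.adjugate = M.adjugate * (M * N) := by rw [h, mul_one]
    _ = M.det • N := by rw [← mul_assoc, Matrix.adjugate_mul, Matrix.smul_mul, one_mul]

end FiniteSection

/-! ### The logarithmic derivative of the determinant, and its integral. -/

section ResolventTrace

variable {ι κ H : Type*} [NormedAddCommGroup H] [InnerProductSpace ℂ H]

/-- The trace of `(1 + P T P)⁻¹ P T' P` for `T(z) = (e^{zh} - 1) K`, where `h K = ∑ ⟨a_n, ·⟩ b_n`. -/
noncomputable def resolventTrace (a b : κ → H) (h K P : H →L[ℂ] H) (z : ℂ) : ℂ :=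
  ∑' n, ⟪P (a n), Ring.inverse (1 + P * ((NormedSpace.exp (z • h) - 1) * K) * P)
    (P (NormedSpace.exp (z • h) (b n)))⟫_ℂ

theorem resolventTrace_one {a b : κ → H} (hab : Summable fun n => ‖a n‖ * ‖b n‖)
    (h K : H →L[ℂ] H) (z : ℂ) : resolventTrace a b h K 1 z =
      nuclearFunctional a b hab (Ring.inverse (1 + (NormedSpace.exp (z • h) - 1) * K) *
        NormedSpace.exp (z • h)) := by
  simp [resolventTrace, nuclearFunctional_apply]

variable [CompleteSpace H]

theorem norm_compress_le {P T : H →L[ℂ] H} (hP : ‖P‖ ≤ 1) (hT : ‖T‖ ≤ 1 / 2) :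
    ‖P * T * P‖ ≤ 1 / 2 :=
  calc ‖P * T * P‖ ≤ ‖P‖ * ‖T‖ * ‖P‖ := norm_mul₃_le ..
    _ ≤ 1 * (1 / 2) * 1 := by gcongr
    _ = 1 / 2 := by norm_num

theorem norm_resolventTrace_term_le {h K P : H →L[ℂ] H} (hK : ‖K‖ ≤ 1) (hP : ‖P‖ ≤ 1) {z : ℂ}
    (hz : 3 * ‖h‖ * ‖z‖ ≤ 1) (x y : H) :
    ‖⟪P x, Ring.inverse (1 + P * ((NormedSpace.exp (z • h) - 1) * K) * P)
      (P (NormedSpace.exp (z • h) y))⟫_ℂ‖ ≤ 3 * (‖x‖ * ‖y‖) := by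
  have hR := norm_inverse_one_add_le norm_one_le (norm_compress_le hP (norm_expDefect_le hK hz))
  have hE : ‖NormedSpace.exp (z • h)‖ ≤ 3 / 2 := by
    have h1 := norm_exp_smul_sub_one_le hz
    have h2 := norm_add_le (NormedSpace.exp (z • h) - 1) 1
    have h3 := norm_one_le (H := H)
    rw [sub_add_cancel] at h2
    linarith
  set R := Ring.inverse (1 + P * ((NormedSpace.exp (z • h) - 1) * K) * P)
  set E := NormedSpace.exp (z • h)
  calc _ ≤ ‖P x‖ * ‖R (P (E y))‖ := norm_inner_le_norm _ _
    _ ≤ (‖P‖ * ‖x‖) * (‖R‖ * (‖P‖ * (‖E‖ * ‖y‖))) := by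
        gcongr
        · exact P.le_opNorm _
        · refine R.le_opNorm_of_le (P.le_opNorm_of_le (E.le_opNorm _))
    _ ≤ (1 * ‖x‖) * (2 * (1 * (3 / 2 * ‖y‖))) := by gcongr
    _ = _ := by ring

theorem norm_resolventTrace_le {a b : κ → H} (hab : Summable fun n => ‖a n‖ * ‖b n‖)
    {h K P : H →L[ℂ] H} (hK : ‖K‖ ≤ 1) (hP : ‖P‖ ≤ 1) {z : ℂ} (hz : 3 * ‖h‖ * ‖z‖ ≤ 1) :
    ‖resolventTrace a b h K P z‖ ≤ 3 * ∑' n, ‖a n‖ * ‖b n‖ :=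
  tsum_of_norm_bounded (hab.hasSum.mul_left 3) fun n =>
    norm_resolventTrace_term_le hK hP hz (a n) (b n)

theorem continuous_exp_smul (h : H →L[ℂ] H) :
    Continuous fun z : ℂ => NormedSpace.exp (z • h) :=
  continuous_iff_continuousAt.2 fun z => (hasDerivAt_exp_smul_const h z).continuousAt

theorem continuousOn_resolventTrace {a b : κ → H} (hab : Summable fun n => ‖a n‖ * ‖b n‖)
    {h K P : H →L[ℂ] H} (hK : ‖K‖ ≤ 1) (hP : ‖P‖ ≤ 1) :
    ContinuousOn (resolventTrace a b h K P) {z | 3 * ‖h‖ * ‖z‖ ≤ 1} := by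
  refine continuousOn_tsum (fun n z hz => ?_) (hab.mul_left 3) fun n z hz =>
    norm_resolventTrace_term_le hK hP hz (a n) (b n)
  have hE : Continuous fun z : ℂ => NormedSpace.exp (z • h) :=
    continuous_exp_smul h
  have hu : IsUnit (1 + P * ((NormedSpace.exp (z • h) - 1) * K) * P) :=
    isUnit_one_add_of_norm_le (norm_compress_le hP (norm_expDefect_le hK hz))
  have hR : ContinuousAt
      (fun z : ℂ => Ring.inverse (1 + P * ((NormedSpace.exp (z • h) - 1) * K) * P)) z := by
    refine ContinuousAt.comp (f := fun z : ℂ => 1 + P * ((NormedSpace.exp (z • h) - 1) * K) * P)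
      (g := Ring.inverse) ?_ (continuous_const.add ((continuous_const.mul
        ((hE.sub continuous_const).mul continuous_const)).mul continuous_const)).continuousAt
    have := NormedRing.inverse_continuousAt hu.unit
    simpa using this
  have hc : ContinuousAt (fun z : ℂ => P (NormedSpace.exp (z • h) (b n))) z :=
    (P.continuous.comp (hE.clm_apply continuous_const)).continuousAt
  exact (continuousAt_const.inner (hR.clm_apply hc)).continuousWithinAt

theorem ofReal_mul_mem {c u : ℝ} {t : ℂ} (hc : 0 ≤ c) (ht : 3 * c * ‖t‖ ≤ 1)
    (hu : u ∈ Set.Icc (0 : ℝ) 1) : 3 * c * ‖(u : ℂ) * t‖ ≤ 1 := by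
  rw [norm_mul, Complex.norm_real, Real.norm_of_nonneg hu.1]
  have h1 : u * ‖t‖ ≤ ‖t‖ := mul_le_of_le_one_left (norm_nonneg _) hu.2
  exact le_trans (by gcongr) ht

theorem continuousOn_resolventTrace_segment {a b : κ → H}
    (hab : Summable fun n => ‖a n‖ * ‖b n‖) {h K P : H →L[ℂ] H} (hK : ‖K‖ ≤ 1) (hP : ‖P‖ ≤ 1)
    {t : ℂ} (ht : 3 * ‖h‖ * ‖t‖ ≤ 1) :
    ContinuousOn (fun u : ℝ => t * resolventTrace a b h K P (u * t)) (Set.Icc 0 1) := by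
  refine continuousOn_const.mul ((continuousOn_resolventTrace hab hK hP).comp
    (by fun_prop) fun u hu => ?_)
  exact ofReal_mul_mem (norm_nonneg _) ht hu

/-- The determinants of the finite sections of `1 + (e^{th} - 1) K`. -/
theorem det_one_add_finiteSection [DecidableEq ι] (e : HilbertBasis ι ℂ H) {a b : κ → H}
    (hab : Summable fun n => ‖a n‖ * ‖b n‖) {h K : H →L[ℂ] H} (hK : ‖K‖ ≤ 1)
    (hN : ∀ x, HasSum (fun n => ⟪a n, x⟫_ℂ • b n) ((h * K) x)) {t : ℂ}
    (ht : 3 * ‖h‖ * ‖t‖ ≤ 1) (s : Finset ι) :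
    (1 + finiteSection e ((NormedSpace.exp (t • h) - 1) * K) s).det =
      Complex.exp (∫ u in (0 : ℝ)..1, t * resolventTrace a b h K (basisProj e s) (u * t)) := by
  set P := basisProj e s with hP
  have hPn : ‖P‖ ≤ 1 := (isStarProjection_basisProj e s).norm_le
  set F : ℝ → ℂ := fun u =>
    (1 + finiteSection e ((NormedSpace.exp (((u : ℂ) * t) • h) - 1) * K) s).det with hF
  have key := eq_mul_exp_integral (F := F)
    (continuousOn_resolventTrace_segment hab hK hPn ht) fun u hu => by
    have hz := ofReal_mul_mem (norm_nonneg h) ht hu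
    have hu := isUnit_one_add_of_norm_le (norm_compress_le hPn (norm_expDefect_le hK hz))
    have hinv := one_add_finiteSection_mul e s hu
    have hd : ∀ i j, HasDerivAt
        (fun u : ℝ => (1 + finiteSection e ((NormedSpace.exp (((u : ℂ) * t) • h) - 1) * K) s) i j)
        (finiteSection e (t • (NormedSpace.exp (((u : ℂ) * t) • h) * (h * K))) s i j) u := by
      intro i j
      have h1 := hasDerivAt_exp_smul_const (𝕂 := ℂ) h ((u : ℂ) * t)
      have h2 : HasDerivAt (fun w : ℂ => w * t) t (u : ℂ) := by
        simpa using (hasDerivAt_id (u : ℂ)).mul_const t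
      have h3 := h1.scomp (u : ℂ) h2
      -- The matrix entry is a fixed continuous linear functional of `e^{zh}`, up to an additive
      -- constant, so its derivative follows from that of the exponential.
      let Θ : (H →L[ℂ] H) →L[ℂ] ℂ :=
        (innerSL ℂ (e i)).comp (ContinuousLinearMap.apply ℂ H (K (e j)))
      have h4 := (Θ.hasFDerivAt.comp_hasDerivAt (u : ℂ) h3).comp_ofReal
      have h5 := h4.const_add ((1 : Matrix s s ℂ) i j - ⟪e i, K (e j)⟫_ℂ)
      refine (h5.congr_deriv ?_).congr_of_eventuallyEq (Eventually.of_forall fun v => ?_)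
      · simp [finiteSection, Θ]
      · simp [finiteSection, Θ]
        ring
    refine (hasDerivAt_det hd).congr_deriv ?_
    rw [adjugate_eq_det_smul hinv, Matrix.smul_mul, Matrix.trace_smul, finiteSection_mul,
      smul_eq_mul, ← hP]
    congr 1
    set R := Ring.inverse (1 + P * ((NormedSpace.exp (((u : ℂ) * t) • h) - 1) * K) * P)
    set E := NormedSpace.exp (((u : ℂ) * t) • h)
    have h6 : ∀ i, HasSum (fun n => ⟪a n, e i⟫_ℂ * ⟪e i, R (P (E (b n)))⟫_ℂ)
        ⟪e i, (R * P * E) ((h * K) (e i))⟫_ℂ := by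
      intro i
      have := (hN (e i)).mapL ((innerSL ℂ (e i)).comp (R * P * E))
      simpa [inner_smul_right] using this
    have h7 := hasSum_sum (s := s) fun i _ => h6 i
    have h8 : ∀ n, ⟪P (a n), R (P (E (b n)))⟫_ℂ =
        ∑ i ∈ s, ⟪a n, e i⟫_ℂ * ⟪e i, R (P (E (b n)))⟫_ℂ := fun n =>
      inner_basisProj_left e s _ _
    rw [resolventTrace, tsum_congr h8, h7.tsum_eq, Matrix.trace, Finset.mul_sum]
    refine Eq.trans ?_ (Finset.sum_coe_sort s fun x => t * ⟪e x, (R * P * E) ((h * K) (e x))⟫_ℂ)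
    simp [finiteSection]
  have h0 : F 0 = 1 := by
    have : finiteSection e (0 : H →L[ℂ] H) s = 0 := by ext i j; simp [finiteSection]
    simp [hF, this]
  have h1 : F 1 = (1 + finiteSection e ((NormedSpace.exp (t • h) - 1) * K) s).det := by
    simp [hF]
  rw [← h1, key, h0, one_mul]

/-- The projections converge only strongly, so the inverses are compared vector by vector. With `x =
(1 + T)⁻¹ y`, the resolvent identity writes `R_s P_s y - x` as `R_s` applied to a vector tending to
`0`, and `‖R_s‖ ≤ 2` uniformly. Dominated convergence over `n` finishes. -/
theorem tendsto_resolventTrace (e : HilbertBasis ι ℂ H) {a b : κ → H}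
    (hab : Summable fun n => ‖a n‖ * ‖b n‖) {h K : H →L[ℂ] H} (hK : ‖K‖ ≤ 1) {z : ℂ}
    (hz : 3 * ‖h‖ * ‖z‖ ≤ 1) :
    Tendsto (fun s => resolventTrace a b h K (basisProj e s) z) atTop
      (𝓝 (resolventTrace a b h K 1 z)) := by
  have hPn : ∀ s, ‖basisProj e s‖ ≤ 1 := fun s => (isStarProjection_basisProj e s).norm_le
  refine tendsto_tsum_of_dominated_convergence (hab.mul_left 3) (fun n => ?_)
    (Eventually.of_forall fun s n => norm_resolventTrace_term_le hK (hPn s) hz (a n) (b n))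
  have hT := norm_expDefect_le hK hz
  set T := (NormedSpace.exp (z • h) - 1) * K
  set y := NormedSpace.exp (z • h) (b n)
  refine (tendsto_basisProj e (a n)).inner ?_
  simp only [one_mul, mul_one, one_apply_eq_self]
  have hW := isUnit_one_add_of_norm_le hT
  set x := Ring.inverse (1 + T) y with hx
  have hxy : x + T x = y := by
    have := congrArg (fun X : H →L[ℂ] H => X y) (Ring.mul_inverse_cancel _ hW)
    simpa [← hx] using this
  have hPTP : Tendsto (fun s => basisProj e s (T (basisProj e s x))) atTop (𝓝 (T x)) := by
    have h1 := tendsto_basisProj e (T x)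
    have h2 : Tendsto (fun s => basisProj e s (T (basisProj e s x) - T x)) atTop (𝓝 0) := by
      have h3 : Tendsto (fun s => ‖T (basisProj e s x) - T x‖) atTop (𝓝 0) := by
        rw [← tendsto_iff_norm_sub_tendsto_zero]
        exact (T.continuous.tendsto x).comp (tendsto_basisProj e x)
      refine squeeze_zero_norm (fun s => ?_) h3
      simpa using (basisProj e s).le_of_opNorm_le (hPn s) (T (basisProj e s x) - T x)
    have h4 := h2.add h1
    simpa [map_sub] using h4
  rw [tendsto_iff_norm_sub_tendsto_zero]
  have h5 : Tendsto (fun s => 2 * ‖(basisProj e s y - y) -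
      (basisProj e s (T (basisProj e s x)) - T x)‖) atTop (𝓝 0) := by
    have := (((tendsto_basisProj e y).sub_const y).sub (hPTP.sub_const (T x))).norm.const_mul 2
    simpa using this
  refine squeeze_zero (fun _ => norm_nonneg _) (fun s => ?_) h5
  have hTs := norm_compress_le (hPn s) hT
  set R := Ring.inverse (1 + basisProj e s * T * basisProj e s) with hR
  have hRn : ‖R‖ ≤ 2 := norm_inverse_one_add_le norm_one_le hTs
  have hRx : x = R (x + basisProj e s (T (basisProj e s x))) := by
    have := congrArg (fun X : H →L[ℂ] H => X x)
      (Ring.inverse_mul_cancel _ (isUnit_one_add_of_norm_le hTs))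
    simpa [← hR] using this.symm
  have h6 : R (basisProj e s y) - x = R ((basisProj e s y - y) -
      (basisProj e s (T (basisProj e s x)) - T x)) := by
    conv_lhs => rw [hRx]
    rw [← map_sub, ← hxy]
    congr 1
    abel
  rw [h6]
  exact R.le_of_opNorm_le hRn _

/-- The Fredholm determinant `det(1 + (e^{th} - 1) K)` as the exponential of an integral. -/
theorem fredholmDet_eq_exp [Countable ι] (e : HilbertBasis ι ℂ H) {a b : κ → H}
    (hab : Summable fun n => ‖a n‖ * ‖b n‖) {h K : H →L[ℂ] H} (hK : ‖K‖ ≤ 1)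
    (hN : ∀ x, HasSum (fun n => ⟪a n, x⟫_ℂ • b n) ((h * K) x)) {t : ℂ}
    (ht : 3 * ‖h‖ * ‖t‖ ≤ 1) :
    fredholmDet e ((NormedSpace.exp (t • h) - 1) * K) =
      Complex.exp (∫ u in (0 : ℝ)..1, t * resolventTrace a b h K 1 (u * t)) := by
  classical
  refine Tendsto.limUnder_eq ?_
  have hPn : ∀ s, ‖basisProj e s‖ ≤ 1 := fun s => (isStarProjection_basisProj e s).norm_le
  have hlim : Tendsto (fun s => Complex.exp
      (∫ u in (0 : ℝ)..1, t * resolventTrace a b h K (basisProj e s) (u * t))) atTop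
      (𝓝 (Complex.exp (∫ u in (0 : ℝ)..1, t * resolventTrace a b h K 1 (u * t)))) := by
    refine (Complex.continuous_exp.tendsto _).comp ?_
    refine intervalIntegral.tendsto_integral_filter_of_dominated_convergence
      (fun _ => ‖t‖ * (3 * ∑' n, ‖a n‖ * ‖b n‖)) (Eventually.of_forall fun s => ?_)
      (Eventually.of_forall fun s => Eventually.of_forall fun u hu => ?_) (by simp)
      (Eventually.of_forall fun u hu => ?_)
    · rw [Set.uIoc_of_le zero_le_one]
      exact ((continuousOn_resolventTrace_segment hab hK (hPn s) ht).mono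
        Set.Ioc_subset_Icc_self).aestronglyMeasurable measurableSet_Ioc
    · rw [Set.uIoc_of_le zero_le_one] at hu
      rw [norm_mul]
      gcongr
      exact norm_resolventTrace_le hab hK (hPn s)
        (ofReal_mul_mem (norm_nonneg _) ht (Set.Ioc_subset_Icc_self hu))
    · rw [Set.uIoc_of_le zero_le_one] at hu
      exact (tendsto_resolventTrace e hab hK
        (ofReal_mul_mem (norm_nonneg _) ht (Set.Ioc_subset_Icc_self hu))).const_mul t
  refine hlim.congr fun s => ?_
  rw [← det_one_add_finiteSection e hab hK hN ht s]

theorem continuousOn_integral_resolventTrace {a b : κ → H}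
    (hab : Summable fun n => ‖a n‖ * ‖b n‖) {h K : H →L[ℂ] H} (hK : ‖K‖ ≤ 1) :
    ContinuousOn (fun t : ℂ => ∫ u in (0 : ℝ)..1, t * resolventTrace a b h K 1 (u * t))
      {t | 3 * ‖h‖ * ‖t‖ ≤ 1} := by
  intro t ht
  have h1 := norm_one_le (H := H)
  have hev : ∀ᶠ x in 𝓝[{t | 3 * ‖h‖ * ‖t‖ ≤ 1}] t, 3 * ‖h‖ * ‖x‖ ≤ 1 ∧ ‖x‖ ≤ ‖t‖ + 1 := by
    refine Eventually.and self_mem_nhdsWithin (nhdsWithin_le_nhds ?_)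
    exact (continuous_norm.tendsto t).eventually_le_const (lt_add_one _)
  refine intervalIntegral.continuousWithinAt_of_dominated_interval
    (bound := fun _ => (‖t‖ + 1) * (3 * ∑' n, ‖a n‖ * ‖b n‖)) ?_ ?_ (by simp)
    (Eventually.of_forall fun u hu => ?_)
  · filter_upwards [hev] with x hx
    rw [Set.uIoc_of_le zero_le_one]
    exact ((continuousOn_resolventTrace_segment hab hK h1 hx.1).mono
      Set.Ioc_subset_Icc_self).aestronglyMeasurable measurableSet_Ioc
  · filter_upwards [hev] with x hx
    refine Eventually.of_forall fun u hu => ?_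
    rw [Set.uIoc_of_le zero_le_one] at hu
    rw [norm_mul]
    gcongr
    · exact hx.2
    · exact norm_resolventTrace_le hab hK h1
        (ofReal_mul_mem (norm_nonneg _) hx.1 (Set.Ioc_subset_Icc_self hu))
  · rw [Set.uIoc_of_le zero_le_one] at hu
    refine continuousWithinAt_id.mul
      (((continuousOn_resolventTrace hab hK h1) _ ?_).comp (by fun_prop) fun x hx => ?_)
    · exact ofReal_mul_mem (norm_nonneg _) ht (Set.Ioc_subset_Icc_self hu)
    · exact ofReal_mul_mem (norm_nonneg _) hx (Set.Ioc_subset_Icc_self hu)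

theorem norm_integral_resolventTrace_sub_le (e : HilbertBasis ι ℂ H) {a b : κ → H}
    (hab : Summable fun n => ‖a n‖ * ‖b n‖) {h K : H →L[ℂ] H} (hK : IsStarProjection K)
    (hN : ∀ x, HasSum (fun n => ⟪a n, x⟫_ℂ • b n) ((h * K) x)) (haK : ∀ n, K (a n) = a n)
    (hS : hsSq e (h * K - K * h) ≠ ⊤) {t : ℂ} (ht : 3 * ‖h‖ * ‖t‖ ≤ 1) :
    ‖(∫ u in (0 : ℝ)..1, t * resolventTrace a b h K 1 (u * t)) - t * trace e (h * K)‖ ≤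
      3 * ‖t‖ ^ 2 * hilbertSchmidtNorm e (h * K - K * h) ^ 2 := by
  have htr : trace e (h * K) = nuclearFunctional a b hab 1 := by
    have := (hasSum_inner_mul_nuclear e hab hN 1).tsum_eq
    simpa [trace, nuclearFunctional_apply] using this
  have hint : IntervalIntegrable (fun u : ℝ => t * resolventTrace a b h K 1 (u * t)) volume 0 1 := by
    refine ContinuousOn.intervalIntegrable ?_
    rw [Set.uIcc_of_le zero_le_one]
    exact continuousOn_resolventTrace_segment hab hK.norm_le norm_one_le ht
  have h1 : t * trace e (h * K) = ∫ u in (0 : ℝ)..1, t * nuclearFunctional a b hab 1 := by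
    rw [htr]; simp
  rw [h1, ← intervalIntegral.integral_sub hint (by simp), hilbertSchmidtNorm_sq]
  have h2 := intervalIntegral.norm_integral_le_of_norm_le_const (a := (0 : ℝ)) (b := 1)
    (C := 3 * ‖t‖ ^ 2 * (hsSq e (h * K - K * h)).toReal)
    (f := fun u => t * resolventTrace a b h K 1 (u * t) - t * nuclearFunctional a b hab 1)
    fun u hu => by
      rw [Set.uIoc_of_le zero_le_one] at hu
      have hu' := Set.Ioc_subset_Icc_self hu
      rw [← mul_sub, norm_mul, resolventTrace_one hab]
      have h3 := norm_nuclear_sub_le e hab hK hN haK hS (ofReal_mul_mem (norm_nonneg _) ht hu')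
      have h4 : ‖(u : ℂ) * t‖ ≤ ‖t‖ := by
        rw [norm_mul, Complex.norm_real, Real.norm_of_nonneg hu'.1]
        exact mul_le_of_le_one_left (norm_nonneg _) hu'.2
      calc _ ≤ ‖t‖ * (3 * ‖(u : ℂ) * t‖ * (hsSq e (h * K - K * h)).toReal) := by gcongr
        _ ≤ ‖t‖ * (3 * ‖t‖ * (hsSq e (h * K - K * h)).toReal) := by
            have := ENNReal.toReal_nonneg (a := hsSq e (h * K - K * h))
            gcongr
        _ = _ := by ring
  simpa using h2

end ResolventTrace

/-! ### The logarithm of the Fredholm determinant in a separable space. -/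

section FredholmLogarithm

variable {ι H : Type*} [NormedAddCommGroup H] [InnerProductSpace ℂ H]

/-- Balls of radius `1/2` around the vectors are disjoint. Countability of the index set makes
`atTop` on its finite subsets countably generated, as dominated convergence requires. -/
theorem countable_of_orthonormal [TopologicalSpace.SeparableSpace H] {v : ι → H}
    (hv : Orthonormal ℂ v) : Countable ι := by
  refine Pairwise.countable_of_isOpen_disjoint (s := fun i => Metric.ball (v i) (1 / 2))
    (fun i j hij => ?_) (fun i => Metric.isOpen_ball) fun i =>
      ⟨v i, Metric.mem_ball_self (by norm_num)⟩
  refine Set.disjoint_left.2 fun x hi hj => ?_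
  rw [Metric.mem_ball, dist_comm] at hi
  rw [Metric.mem_ball] at hj
  have h1 : dist (v i) (v j) < 1 := by linarith [dist_triangle (v i) x (v j)]
  have h2 : ⟪v i, v i - v j⟫_ℂ = 1 := by
    rw [inner_sub_right, hv.2 hij, inner_self_eq_norm_sq_to_K, hv.1 i]; simp
  have h3 := norm_inner_le_norm (𝕜 := ℂ) (v i) (v i - v j)
  rw [h2, hv.1 i, ← dist_eq_norm] at h3
  simp at h3
  linarith

variable [CompleteSpace H]

theorem exists_log_fredholmDet [TopologicalSpace.SeparableSpace H] (e : HilbertBasis ι ℂ H)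
    {K h : H →L[ℂ] H} (hK : IsStarProjection K) (h1 : IsTraceClass (h * K))
    (h2 : IsTraceClass (K * h)) :
    ∃ L : ℂ → ℂ, ContinuousOn L {t | 3 * ‖h‖ * ‖t‖ ≤ 1} ∧ L 0 = 0 ∧
      ∀ t : ℂ, 3 * ‖h‖ * ‖t‖ ≤ 1 →
        Complex.exp (L t) = fredholmDet e ((NormedSpace.exp (t • h) - 1) * K) ∧
        ‖L t - t * trace e (h * K)‖ ≤ 3 * ‖t‖ ^ 2 * hilbertSchmidtNorm e (h * K - K * h) ^ 2 := by
  have := countable_of_orthonormal e.orthonormal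
  obtain ⟨a₀, b, hab₀, hN₀⟩ := h1
  obtain ⟨a', b', hab', hN'⟩ := h2
  have hKK : K * K = K := hK.isIdempotentElem
  -- Since `hK = (hK)K`, each `a₀ n` may be replaced by `K (a₀ n)`; this puts the left vectors in
  -- the range of `K`.
  set a : ℕ → H := fun n => K (a₀ n) with ha
  have hab : Summable fun n => ‖a n‖ * ‖b n‖ := by
    refine Summable.of_nonneg_of_le (fun n => by positivity) (fun n => ?_) hab₀
    gcongr
    simpa using K.le_of_opNorm_le hK.norm_le (a₀ n)
  have hN : ∀ x, HasSum (fun n => ⟪a n, x⟫_ℂ • b n) ((h * K) x) := by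
    intro x
    have h3 := hN₀ (K x)
    have h4 : (h * K) (K x) = (h * K) x := by
      change (h * (K * K)) x = (h * K) x
      rw [hKK]
    rw [h4] at h3
    convert h3 using 3 with n
    have h5 := ContinuousLinearMap.adjoint_inner_left K x (a₀ n)
    rw [← ContinuousLinearMap.star_eq_adjoint, hK.isSelfAdjoint.star_eq] at h5
    exact h5
  have haK : ∀ n, K (a n) = a n := fun n => congrArg (fun X : H →L[ℂ] H => X (a₀ n)) hKK
  have hS : hsSq e (h * K - K * h) ≠ ⊤ := by
    refine ne_top_of_le_ne_top ?_ (hsSq_sub_le e _ _)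
    have h3 := hsSq_nuclear_ne_top e hab hN
    have h4 := hsSq_nuclear_ne_top e hab' hN'
    finiteness
  refine ⟨fun t => ∫ u in (0 : ℝ)..1, t * resolventTrace a b h K 1 (u * t),
    continuousOn_integral_resolventTrace hab hK.norm_le, by simp, fun t ht => ⟨?_, ?_⟩⟩
  · exact (fredholmDet_eq_exp e hab hK.norm_le hN ht).symm
  · exact norm_integral_resolventTrace_sub_le e hab hK hN haK hS ht

end FredholmLogarithm

/-! ### Finite-rank projections: cumulants as Fredholm determinants. -/

section FiniteRank

variable {ι H : Type*} [NormedAddCommGroup H] [InnerProductSpace ℂ H] {N : ℕ} {φ : Fin N → H}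
  {K h : H →L[ℂ] H}

/-- `det(1 + (X - 1) K)` for the projection `K` onto the span of an orthonormal family `φ` is the
determinant of the compression of `X` to that span. -/
theorem fredholmDet_eq_det (e : HilbertBasis ι ℂ H) (hφ : Orthonormal ℂ φ)
    (hKφ : ∀ x, K x = ∑ j, ⟪φ j, x⟫_ℂ • φ j) (X : H →L[ℂ] H) :
    fredholmDet e ((X - 1) * K) = (Matrix.of fun i j => ⟪φ i, X (φ j)⟫_ℂ).det := by
  classical
  refine Tendsto.limUnder_eq ?_
  -- Factor the section through the range of `K` as `A B` and use `det(1 + AB) = det(1 + BA)`: the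
  -- second matrix has fixed size `N`, and its entries converge by Parseval.
  let A : (s : Finset ι) → Matrix s (Fin N) ℂ := fun s => Matrix.of fun i j =>
    ⟪e i, (X - 1) (φ j)⟫_ℂ
  let B : (s : Finset ι) → Matrix (Fin N) s ℂ := fun s => Matrix.of fun j i => ⟪φ j, e i⟫_ℂ
  have h1 : ∀ s, finiteSection e ((X - 1) * K) s = A s * B s := by
    intro s
    ext i k
    simp only [finiteSection, Matrix.of_apply, mul_apply_eq_comp, Matrix.mul_apply, A, B, hKφ,
      map_sum, map_smul, inner_sum, inner_smul_right]
    exact Finset.sum_congr rfl fun j _ => mul_comm _ _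
  have h2 : Tendsto (fun s => (1 + B s * A s).det) atTop
      (𝓝 (Matrix.of fun i j => ⟪φ i, X (φ j)⟫_ℂ).det) := by
    refine ((continuous_id.matrix_det).tendsto _).comp ?_
    refine tendsto_pi_nhds.2 fun j => tendsto_pi_nhds.2 fun k => ?_
    have h3 := e.hasSum_inner_mul_inner (φ j) ((X - 1) (φ k))
    have h4 : (Matrix.of fun i j => ⟪φ i, X (φ j)⟫_ℂ) j k =
        (1 : Matrix (Fin N) (Fin N) ℂ) j k + ⟪φ j, (X - 1) (φ k)⟫_ℂ := by
      simp [Matrix.one_apply, orthonormal_iff_ite.1 hφ]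
    rw [h4]
    refine (h3.const_add _).congr fun s => ?_
    simp only [Matrix.add_apply, Matrix.mul_apply, A, B, Matrix.of_apply]
    congr 1
    exact (Finset.sum_coe_sort s fun i => ⟪φ j, e i⟫_ℂ * ⟪e i, (X - 1) (φ k)⟫_ℂ).symm
  refine h2.congr fun s => ?_
  rw [h1, Matrix.det_one_add_mul_comm]

theorem hasSum_finiteRank (hKφ : ∀ x, K x = ∑ j, ⟪φ j, x⟫_ℂ • φ j) (x : H) :
    HasSum (fun j => ⟪φ j, x⟫_ℂ • h (φ j)) ((h * K) x) := by
  have h1 : (h * K) x = ∑ j, ⟪φ j, x⟫_ℂ • h (φ j) := by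
    rw [mul_apply_eq_comp, hKφ, map_sum]
    simp
  rw [h1]
  exact hasSum_fintype _

theorem apply_basis (hφ : Orthonormal ℂ φ) (hKφ : ∀ x, K x = ∑ j, ⟪φ j, x⟫_ℂ • φ j) (j : Fin N) :
    K (φ j) = φ j := by
  rw [hKφ]
  simp [orthonormal_iff_ite.1 hφ]

variable [CompleteSpace H]

theorem norm_sq_eq_sum (hK : IsStarProjection K) (hKφ : ∀ x, K x = ∑ j, ⟪φ j, x⟫_ℂ • φ j) (x : H) :
    ‖K x‖ₑ ^ 2 = ∑ j, ‖⟪φ j, x⟫_ℂ‖ₑ ^ 2 := by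
  have h1 : ⟪K x, K x⟫_ℂ = ⟪x, K x⟫_ℂ := by
    have h5 := ContinuousLinearMap.adjoint_inner_left K (K x) x
    rw [← ContinuousLinearMap.star_eq_adjoint, hK.isSelfAdjoint.star_eq] at h5
    rw [h5]
    exact congrArg (fun X : H →L[ℂ] H => ⟪x, X x⟫_ℂ) hK.isIdempotentElem
  have h2 : ‖K x‖ ^ 2 = ∑ j, ‖⟪φ j, x⟫_ℂ‖ ^ 2 := by
    have h3 : (((‖K x‖ ^ 2 : ℝ)) : ℂ) = ((∑ j, ‖⟪φ j, x⟫_ℂ‖ ^ 2 : ℝ) : ℂ) := by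
      push_cast
      have := inner_self_eq_norm_sq_to_K (𝕜 := ℂ) (K x)
      rw [h1, hKφ x, inner_sum] at this
      rw [← hKφ x] at this
      refine Eq.trans this.symm (Finset.sum_congr rfl fun j _ => ?_)
      rw [inner_smul_right, ← Complex.mul_conj', inner_conj_symm]
    exact_mod_cast h3
  have h4 : ∀ z : ℝ, 0 ≤ z → ENNReal.ofReal (z ^ 2) = ENNReal.ofReal z ^ 2 :=
    fun z hz => ENNReal.ofReal_pow hz 2
  simp_rw [← ofReal_norm, ← h4 _ (norm_nonneg _)]
  rw [h2, ENNReal.ofReal_sum_of_nonneg fun _ _ => by positivity]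

/-- `[h, K]` is the difference of `(1 - K)hK` and its adjoint, two operators of equal
Hilbert–Schmidt norm. The crude `‖X - Y‖² ≤ 2‖X‖² + 2‖Y‖²` yields the `4`. -/
theorem hsSq_commutator_le (e : HilbertBasis ι ℂ H) (hK : IsStarProjection K)
    (hKφ : ∀ x, K x = ∑ j, ⟪φ j, x⟫_ℂ • φ j) (hh : IsSelfAdjoint h) :
    hsSq e (h * K - K * h) ≤ ENNReal.ofReal (4 * ∑ j, ‖(1 - K) (h (φ j))‖ ^ 2) := by
  have h1 : h * K - K * h = (1 - K) * h * K - K * h * (1 - K) := by noncomm_ring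
  have h2 : star (K * h * (1 - K)) = (1 - K) * h * K := by
    rw [star_mul, star_mul, hK.isSelfAdjoint.star_eq, hK.one_sub.isSelfAdjoint.star_eq, hh.star_eq,
      mul_assoc]
  have h3 : hsSq e (K * h * (1 - K)) = ∑ j, ‖(1 - K) (h (φ j))‖ₑ ^ 2 := by
    have h4 : ∀ i j, ‖⟪φ j, h ((1 - K) (e i))⟫_ℂ‖ₑ = ‖⟪e i, (1 - K) (h (φ j))⟫_ℂ‖ₑ := by
      intro i j
      have h5 := ContinuousLinearMap.adjoint_inner_left h ((1 - K) (e i)) (φ j)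
      have h6 := ContinuousLinearMap.adjoint_inner_left (1 - K) (e i) (h (φ j))
      rw [← ContinuousLinearMap.star_eq_adjoint, hh.star_eq] at h5
      rw [← ContinuousLinearMap.star_eq_adjoint, hK.one_sub.isSelfAdjoint.star_eq] at h6
      rw [← h5, ← h6, ← ofReal_norm, ← ofReal_norm, norm_inner_symm]
    simp only [hsSq, mul_apply_eq_comp, norm_sq_eq_sum hK hKφ, h4]
    rw [Summable.tsum_finsetSum fun _ _ => ENNReal.summable]
    exact Finset.sum_congr rfl fun j _ => (enorm_sq_eq_tsum e _).symm
  have h4 : ∑ j, ‖(1 - K) (h (φ j))‖ₑ ^ 2 = ENNReal.ofReal (∑ j, ‖(1 - K) (h (φ j))‖ ^ 2) := by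
    rw [ENNReal.ofReal_sum_of_nonneg fun _ _ => by positivity]
    exact Finset.sum_congr rfl fun j _ => by rw [ENNReal.ofReal_pow (norm_nonneg _), ofReal_norm]
  rw [h1]
  refine (hsSq_sub_le e _ _).trans ?_
  rw [← h2, hsSq_adjoint, h3, h4, ENNReal.ofReal_mul (by norm_num), ← add_mul]
  norm_num

theorem resolventTrace_eq_sum (a b : Fin N → H) (z : ℂ) :
    resolventTrace a b h K 1 z = ∑ j, ⟪a j, (Ring.inverse (1 + (NormedSpace.exp (z • h) - 1) * K) *
      NormedSpace.exp (z • h)) (b j)⟫_ℂ := by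
  simp [resolventTrace]

/-- At `0` the product `R e^{zh}` has derivative `-hK + h = h(1 - K)`, and `⟨φ_j, h(1 - K)hφ_j⟩ =
‖(1 - K)hφ_j‖²`. In the application this value is the variance. -/
theorem hasDerivAt_resolventTrace_zero (hK : IsStarProjection K) (hh : IsSelfAdjoint h) :
    HasDerivAt (resolventTrace φ (fun j => h (φ j)) h K 1)
      ((∑ j, ‖(1 - K) (h (φ j))‖ ^ 2 : ℝ) : ℂ) 0 := by
  have hE : HasDerivAt (fun z : ℂ => NormedSpace.exp (z • h)) h 0 := by
    simpa using hasDerivAt_exp_smul_const h (0 : ℂ)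
  have hW : HasDerivAt (fun z : ℂ => 1 + (NormedSpace.exp (z • h) - 1) * K) (h * K) 0 :=
    ((hE.sub_const 1).mul_const K).const_add 1
  have hR : HasDerivAt (fun z : ℂ => Ring.inverse (1 + (NormedSpace.exp (z • h) - 1) * K))
      (-(h * K)) 0 := by
    have h1 := hasFDerivAt_ringInverse (𝕜 := ℂ) (1 : (H →L[ℂ] H)ˣ)
    have h2 : (1 : H →L[ℂ] H) + (NormedSpace.exp ((0 : ℂ) • h) - 1) * K =
        ((1 : (H →L[ℂ] H)ˣ) : H →L[ℂ] H) := by simp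
    have h3 := HasFDerivAt.comp_hasDerivAt_of_eq (0 : ℂ) h1 hW h2.symm
    refine h3.congr_deriv ?_
    simp [ContinuousLinearMap.mulLeftRight_apply]
  have hY := hR.mul hE
  have h4 : -(h * K) * NormedSpace.exp ((0 : ℂ) • h) +
      Ring.inverse (1 + (NormedSpace.exp ((0 : ℂ) • h) - 1) * K) * h = h * (1 - K) := by
    simp only [zero_smul, NormedSpace.exp_zero, sub_self, zero_mul, add_zero, Ring.inverse_one]
    noncomm_ring
  rw [h4] at hY
  have h5 : resolventTrace φ (fun j => h (φ j)) h K 1 = fun z => ∑ j,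
      ((innerSL ℂ (φ j)).comp (ContinuousLinearMap.apply ℂ H (h (φ j))))
        (Ring.inverse (1 + (NormedSpace.exp (z • h) - 1) * K) * NormedSpace.exp (z • h)) := by
    ext z
    rw [resolventTrace_eq_sum]
    rfl
  rw [h5]
  refine (HasDerivAt.fun_sum fun j _ => (ContinuousLinearMap.hasFDerivAt _).comp_hasDerivAt
    (0 : ℂ) hY).congr_deriv ?_
  push_cast
  refine Finset.sum_congr rfl fun j _ => ?_
  have h6 := ContinuousLinearMap.adjoint_inner_left h ((1 - K) (h (φ j))) (φ j)
  have h7 := ContinuousLinearMap.adjoint_inner_left (1 - K) ((1 - K) (h (φ j))) (h (φ j))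
  rw [← ContinuousLinearMap.star_eq_adjoint, hh.star_eq] at h6
  rw [← ContinuousLinearMap.star_eq_adjoint, hK.one_sub.isSelfAdjoint.star_eq,
    inner_self_eq_norm_sq_to_K] at h7
  have h8 : (1 - K) ((1 - K) (h (φ j))) = (1 - K) (h (φ j)) :=
    congrArg (fun X : H →L[ℂ] H => X (h (φ j))) hK.one_sub.isIdempotentElem
  rw [h8] at h7
  exact h6.symm.trans h7.symm

theorem resolventTrace_zero (a b : Fin N → H) :
    resolventTrace a b h K 1 0 = ∑ j, ⟪a j, b j⟫_ℂ := by
  simp [resolventTrace_eq_sum]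

/-- The first two derivatives at `0` and a quadratic bound for a cumulant generating function
`c` with `e^{c(t)} = det(⟨φ_i, e^{th} φ_j⟩)`. -/
theorem cumulant_of_exp_eq_det [TopologicalSpace.SeparableSpace H] (hφ : Orthonormal ℂ φ)
    (hK : IsStarProjection K) (hKφ : ∀ x, K x = ∑ j, ⟪φ j, x⟫_ℂ • φ j) (hh : IsSelfAdjoint h)
    {c : ℝ → ℝ} (hc : ∀ t : ℝ, ((Real.exp (c t) : ℝ) : ℂ) =
      (Matrix.of fun i j => ⟪φ i, NormedSpace.exp ((t : ℂ) • h) (φ j)⟫_ℂ).det) :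
    deriv (deriv c) 0 = ∑ j, ‖(1 - K) (h (φ j))‖ ^ 2 ∧
    ∀ t : ℝ, 3 * ‖h‖ * |t| ≤ 1 →
      |c t - t * deriv c 0| ≤ 12 * t ^ 2 * ∑ j, ‖(1 - K) (h (φ j))‖ ^ 2 := by
  obtain ⟨w, e, -⟩ := exists_hilbertBasis ℂ H
  have := countable_of_orthonormal e.orthonormal
  set b : Fin N → H := fun j => h (φ j) with hb
  have hab : Summable fun j => ‖φ j‖ * ‖b j‖ := (hasSum_fintype _).summable
  have hN : ∀ x, HasSum (fun j => ⟪φ j, x⟫_ℂ • b j) ((h * K) x) := hasSum_finiteRank hKφ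
  set Φ : ℂ → ℂ := resolventTrace φ b h K 1 with hΦ
  have hnorm : ∀ t : ℝ, 3 * ‖h‖ * |t| ≤ 1 → 3 * ‖h‖ * ‖(t : ℂ)‖ ≤ 1 := fun t ht => by
    simpa using ht
  -- Taking moduli of the two exponentials identifies `c` with the real part of the logarithm,
  -- without any discussion of branches.
  have hcL : ∀ t : ℝ, 3 * ‖h‖ * |t| ≤ 1 →
      c t = (∫ u in (0 : ℝ)..1, (t : ℂ) * Φ (u * t)).re := by
    intro t ht
    have h1 := hc t
    rw [← fredholmDet_eq_det e hφ hKφ, fredholmDet_eq_exp e hab hK.norm_le hN (hnorm t ht)] at h1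
    have h2 := congrArg norm h1
    rw [Complex.norm_exp, Complex.norm_real, Real.norm_of_nonneg (Real.exp_pos _).le] at h2
    exact Real.exp_injective h2
  have hcΦ : ∀ t : ℝ, 3 * ‖h‖ * |t| ≤ 1 → c t = (∫ s in (0 : ℝ)..t, Φ s).re := by
    intro t ht
    rw [hcL t ht]
    have h1 := intervalIntegral.smul_integral_comp_mul_right (a := 0) (b := 1)
      (fun s : ℝ => Φ s) t
    rw [zero_mul, one_mul] at h1
    rw [← h1, intervalIntegral.integral_const_mul]
    simp
  set U : Set ℝ := {t | 3 * ‖h‖ * |t| < 1} with hU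
  have hUo : IsOpen U := isOpen_lt (by fun_prop) continuous_const
  have h0U : (0 : ℝ) ∈ U := by simp [hU]
  have hΦc : ContinuousOn (fun s : ℝ => Φ s) U :=
    (continuousOn_resolventTrace hab hK.norm_le norm_one_le).comp (by fun_prop)
      fun t ht => hnorm t (le_of_lt ht)
  have hderiv : ∀ t ∈ U, HasDerivAt c (Φ t).re t := by
    intro t ht
    have hsub : Set.uIcc 0 t ⊆ U := by
      intro s hs
      have : |s| ≤ |t| := by simpa using Set.abs_sub_left_of_mem_uIcc hs
      exact lt_of_le_of_lt (by gcongr) (show 3 * ‖h‖ * |t| < 1 from ht)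
    have h1 : HasDerivAt (fun t : ℝ => ∫ s in (0 : ℝ)..t, Φ s) (Φ t) t :=
      intervalIntegral.integral_hasDerivAt_right (hΦc.mono hsub).intervalIntegrable
        (hΦc.stronglyMeasurableAtFilter hUo _ ht) (hΦc.continuousAt (hUo.mem_nhds ht))
    have h2 := Complex.reCLM.hasFDerivAt.comp_hasDerivAt t h1
    refine h2.congr_of_eventuallyEq ?_
    filter_upwards [hUo.mem_nhds ht] with s hs using hcΦ s (le_of_lt hs)
  have hd0 : deriv c 0 = (∑ j, ⟪φ j, b j⟫_ℂ).re := by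
    rw [(hderiv 0 h0U).deriv, hΦ, Complex.ofReal_zero, resolventTrace_zero]
  refine ⟨?_, fun t ht => ?_⟩
  · have h1 : deriv c =ᶠ[𝓝 0] fun t : ℝ => (Φ t).re := by
      filter_upwards [hUo.mem_nhds h0U] with t ht using (hderiv t ht).deriv
    rw [h1.deriv_eq]
    have h2 : HasDerivAt Φ ((∑ j, ‖(1 - K) (h (φ j))‖ ^ 2 : ℝ) : ℂ) ((0 : ℝ) : ℂ) := by
      rw [Complex.ofReal_zero]; exact hasDerivAt_resolventTrace_zero hK hh
    exact (Complex.reCLM.hasFDerivAt.comp_hasDerivAt (0 : ℝ) h2.comp_ofReal).deriv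
  · have hS := hsSq_commutator_le e hK hKφ hh
    have h1 := norm_integral_resolventTrace_sub_le e hab hK hN (apply_basis hφ hKφ)
      (ne_top_of_le_ne_top ENNReal.ofReal_ne_top hS) (hnorm t ht)
    have htr : trace e (h * K) = ∑ j, ⟪φ j, b j⟫_ℂ := by
      have := (hasSum_inner_mul_nuclear e hab hN 1).tsum_eq
      simpa [trace] using this
    have h2 := (Complex.abs_re_le_norm _).trans h1
    rw [hilbertSchmidtNorm_sq, Complex.sub_re, ← hcL t ht, htr, Complex.re_ofReal_mul, ← hd0,
      Complex.norm_real, Real.norm_eq_abs, sq_abs] at h2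
    refine h2.trans ?_
    have h3 := ENNReal.toReal_mono ENNReal.ofReal_ne_top hS
    rw [ENNReal.toReal_ofReal (by positivity)] at h3
    calc _ ≤ 3 * t ^ 2 * (4 * ∑ j, ‖(1 - K) (h (φ j))‖ ^ 2) := by gcongr
      _ = _ := by ring

end FiniteRank

/-! ### Spectral representation of the kernel. -/

section Kernel

variable {Λ : Type*} [MeasurableSpace Λ] {μ : Measure Λ}

/-- A projection of finite rank has an orthonormal family of eigenvectors spanning its range. -/
theorem exists_orthonormal_of_finiteRank {H : Type*} [NormedAddCommGroup H]
    [InnerProductSpace ℂ H] [CompleteSpace H] {T : H →L[ℂ] H} (hT : IsStarProjection T)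
    (hfin : FiniteDimensional ℂ (LinearMap.range (T : H →ₗ[ℂ] H))) :
    ∃ (N : ℕ) (φ : Fin N → H), Orthonormal ℂ φ ∧ (∀ x, T x = ∑ j, ⟪φ j, x⟫_ℂ • φ j) ∧
      ∀ j, T (φ j) = φ j := by
  let b := stdOrthonormalBasis ℂ (LinearMap.range (T : H →ₗ[ℂ] H))
  have hTb : ∀ j, T (b j : H) = b j := by
    intro j
    obtain ⟨y, hy⟩ := (b j).2
    rw [← hy]
    exact congrArg (fun X : H →L[ℂ] H => X y) hT.isIdempotentElem
  refine ⟨_, fun j => (b j : H), ?_, fun x => ?_, hTb⟩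
  · exact b.orthonormal.comp_linearIsometry (LinearMap.range (T : H →ₗ[ℂ] H)).subtypeₗᵢ
  · have h1 := b.sum_repr' ⟨T x, ⟨x, rfl⟩⟩
    have h2 := congrArg (Subtype.val) h1
    refine h2.symm.trans ?_
    simp only [Submodule.coe_sum, Submodule.coe_smul, Submodule.coe_inner]
    refine Finset.sum_congr rfl fun j _ => ?_
    have h5 := ContinuousLinearMap.adjoint_inner_left T x (b j : H)
    rw [← ContinuousLinearMap.star_eq_adjoint, hT.isSelfAdjoint.star_eq, hTb j] at h5
    rw [← h5]

/-- On the diagonal, the absolutely convergent reproducing integral is `∫ |K(y, z)|² dμ(y)`. -/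
theorem memLp_kernel {K : Λ → Λ → ℂ} (hK : IsFiniteRankProjectionKernel μ K) (z : Λ) :
    MemLp (fun x => K x z) 2 μ := by
  have hm : Measurable fun x => K x z := hK.measurable.of_uncurry_right
  rw [memLp_two_iff_integrable_sq_norm hm.aestronglyMeasurable]
  refine (hK.integrable z z).norm.congr (Eventually.of_forall fun y => ?_)
  simp only [norm_mul, hK.hermitian y z, RCLike.norm_conj, sq]

/-- The spectral representation `K(x, z) = ∑_j ψ_j(x) conj ψ_j(z)` of a projection kernel. -/
theorem exists_spectral_representation {K : Λ → Λ → ℂ} (hK : IsFiniteRankProjectionKernel μ K) :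
    ∃ (T : Lp ℂ 2 μ →L[ℂ] Lp ℂ 2 μ) (N : ℕ) (φ : Fin N → Lp ℂ 2 μ) (ψ : Fin N → Λ → ℂ),
      IsStarProjection T ∧ Orthonormal ℂ φ ∧ (∀ g, T g = ∑ j, ⟪φ j, g⟫_ℂ • φ j) ∧
      (∀ j, ψ j =ᵐ[μ] φ j) ∧ ∀ x z, K x z = ∑ j, ψ j x * starRingEnd ℂ (ψ j z) := by
  obtain ⟨T, hTK, hT, hfin⟩ := hK.finiteRank
  obtain ⟨N, φ, hφ, hTφ, hφT⟩ := exists_orthonormal_of_finiteRank hT hfin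
  -- The sections `k z = K(·, z)` satisfy `⟨k x, k z⟩ = K x z` and are fixed by `T`. Taking `ψ j x =
  -- ⟨k x, φ j⟩` as representatives makes the expansion hold at every pair of points, not just
  -- almost everywhere.
  let k : Λ → Lp ℂ 2 μ := fun z => (memLp_kernel hK z).toLp
  have hk : ∀ z, k z =ᵐ[μ] fun x => K x z := fun z => (memLp_kernel hK z).coeFn_toLp
  have hinner : ∀ x (g : Lp ℂ 2 μ), ⟪k x, g⟫_ℂ = ∫ y, K x y * g y ∂μ := by
    intro x g
    rw [L2.inner_def]
    refine integral_congr_ae ?_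
    filter_upwards [hk x] with y hy
    rw [hy, RCLike.inner_apply, ← hK.hermitian, mul_comm]
  have hkk : ∀ x z, ⟪k x, k z⟫_ℂ = K x z := by
    intro x z
    rw [hinner, ← hK.reproducing x z]
    refine integral_congr_ae ?_
    filter_upwards [hk z] with y hy
    rw [hy]
  have hTk : ∀ z, T (k z) = k z := by
    intro z
    refine Lp.ext ?_
    filter_upwards [hTK (k z), hk z] with x hx hx'
    rw [hx, hx', ← hinner, hkk]
  refine ⟨T, N, φ, fun j x => ⟪k x, φ j⟫_ℂ, hT, hφ, hTφ, fun j => ?_, fun x z => ?_⟩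
  · have h1 := hTK (φ j)
    rw [hφT j] at h1
    filter_upwards [h1] with x hx
    rw [hx, hinner]
  · rw [← hkk x z]
    conv_lhs => rw [← hTk z, hTφ, inner_sum]
    refine Finset.sum_congr rfl fun j _ => ?_
    rw [inner_smul_right, inner_conj_symm, mul_comm]

end Kernel

/-! ### Andréief's identity. -/

section Andreief

variable {Λ : Type*} [MeasurableSpace Λ] {μ : Measure Λ} [SigmaFinite μ] {N : ℕ}

/-- Andréief's identity, with integrability. -/
theorem andreief {w : Λ → ℂ} {ψ χ : Fin N → Λ → ℂ}
    (hint : ∀ i j, Integrable (fun x => w x * (ψ i x * χ j x)) μ) :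
    Integrable (fun x : Fin N → Λ => (∏ i, w (x i)) *
      (Matrix.of fun i j => ∑ k, ψ k (x i) * χ k (x j)).det) (Measure.pi fun _ => μ) ∧
    ∫ x : Fin N → Λ, (∏ i, w (x i)) *
      (Matrix.of fun i j => ∑ k, ψ k (x i) * χ k (x j)).det ∂(Measure.pi fun _ => μ) =
      N.factorial * (Matrix.of fun i j => ∫ x, w x * (ψ i x * χ j x) ∂μ).det := by
  -- Expanding both determinants leaves products of one-variable functions. After Fubini, the sum
  -- over `σ` gives the same determinant for each `τ`; hence the factor `N!`.
  have hexp : ∀ x : Fin N → Λ, (∏ i, w (x i)) *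
      (Matrix.of fun i j => ∑ k, ψ k (x i) * χ k (x j)).det =
      ∑ τ : Equiv.Perm (Fin N), ∑ σ : Equiv.Perm (Fin N),
        ((Equiv.Perm.sign τ : ℤ) : ℂ) * ((Equiv.Perm.sign σ : ℤ) : ℂ) *
          ∏ i, w (x i) * (ψ (σ i) (x i) * χ (τ i) (x i)) := by
    intro x
    have h1 : (Matrix.of fun i j => ∑ k, ψ k (x i) * χ k (x j)) =
        (Matrix.of fun k i => ψ k (x i)).transpose * Matrix.of fun k i => χ k (x i) := by
      ext i j; simp [Matrix.mul_apply]
    rw [h1, Matrix.det_mul, Matrix.det_transpose, Matrix.det_apply', Matrix.det_apply',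
      Finset.sum_mul_sum, Finset.sum_comm, Finset.mul_sum]
    refine Finset.sum_congr rfl fun τ _ => ?_
    rw [Finset.mul_sum]
    refine Finset.sum_congr rfl fun σ _ => ?_
    simp only [Finset.prod_mul_distrib, Matrix.of_apply]
    ring
  have hI : ∀ τ σ : Equiv.Perm (Fin N), Integrable (fun x : Fin N → Λ =>
      ((Equiv.Perm.sign τ : ℤ) : ℂ) * ((Equiv.Perm.sign σ : ℤ) : ℂ) *
          ∏ i, w (x i) * (ψ (σ i) (x i) * χ (τ i) (x i))) (Measure.pi fun _ => μ) := fun τ σ =>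
    (Integrable.fintype_prod fun i => hint (σ i) (τ i)).const_mul _
  simp_rw [hexp]
  refine ⟨integrable_finsetSum _ fun τ _ => integrable_finsetSum _ fun σ _ => hI τ σ, ?_⟩
  rw [integral_finsetSum _ fun τ _ => integrable_finsetSum _ fun σ _ => hI τ σ]
  have hτ : ∀ τ : Equiv.Perm (Fin N), ∫ x : Fin N → Λ, ∑ σ : Equiv.Perm (Fin N),
        ((Equiv.Perm.sign τ : ℤ) : ℂ) * ((Equiv.Perm.sign σ : ℤ) : ℂ) *
          ∏ i, w (x i) * (ψ (σ i) (x i) * χ (τ i) (x i)) ∂(Measure.pi fun _ => μ) =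
      (Matrix.of fun i j => ∫ x, w x * (ψ i x * χ j x) ∂μ).det := by
    intro τ
    rw [integral_finsetSum _ fun σ _ => hI τ σ]
    have h2 := Matrix.det_permute' τ (Matrix.of fun i j => ∫ x, w x * (ψ i x * χ j x) ∂μ)
    have h3 : ((Equiv.Perm.sign τ : ℤ) : ℂ) * ((Equiv.Perm.sign τ : ℤ) : ℂ) = 1 := by
      rw [← Int.cast_mul]; simp
    calc _ = ((Equiv.Perm.sign τ : ℤ) : ℂ) * ((Matrix.of fun i j =>
          ∫ x, w x * (ψ i x * χ j x) ∂μ).submatrix id τ).det := by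
          rw [Matrix.det_apply', Finset.mul_sum]
          refine Finset.sum_congr rfl fun σ _ => ?_
          rw [integral_const_mul, integral_fintype_prod_eq_prod
            (fun i y => w y * (ψ (σ i) y * χ (τ i) y)), mul_assoc]
          rfl
      _ = _ := by rw [h2, ← mul_assoc, h3, one_mul]
  simp_rw [hτ]
  simp [Fintype.card_perm]

/-- A matrix of scalar products of vectors in dimension `N` with more than `N` rows is singular. -/
theorem det_eq_zero_of_lt {k : ℕ} (hk : N < k) (A : Matrix (Fin k) (Fin N) ℂ)
    (B : Matrix (Fin N) (Fin k) ℂ) : (A * B).det = 0 := by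
  by_contra h
  have h1 := Matrix.rank_of_isUnit (A * B) ((Matrix.isUnit_iff_isUnit_det _).2 (Ne.isUnit h))
  have h2 := (Matrix.rank_mul_le_left A B).trans A.rank_le_width
  simp at h1
  omega

end Andreief

/-! ### Multiplication operators on `L²`. -/

section MulOperator

variable {Λ : Type*} [MeasurableSpace Λ] {μ : Measure Λ}

theorem memLp_mul {f : Λ → ℝ} (hf : Measurable f) {C : ℝ} (hC : ∀ x, |f x| ≤ C) (g : Lp ℂ 2 μ) :
    MemLp (fun x => (f x : ℂ) * g x) 2 μ := by
  refine (Lp.memLp g).of_le_mul (c := C) ?_ (Eventually.of_forall fun x => ?_)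
  · exact (Complex.measurable_ofReal.comp hf).aestronglyMeasurable.mul (Lp.aestronglyMeasurable g)
  · rw [norm_mul, Complex.norm_real]
    gcongr
    exact hC x

/-- Multiplication by a bounded measurable function, as an operator on `L²`. -/
noncomputable def mulOperator (μ : Measure Λ) {f : Λ → ℝ} (hf : Measurable f) {C : ℝ}
    (hC : ∀ x, |f x| ≤ C) : Lp ℂ 2 μ →L[ℂ] Lp ℂ 2 μ :=
  LinearMap.mkContinuous
    { toFun := fun g => (memLp_mul hf hC g).toLp
      map_add' := fun g g' => by
        rw [← MemLp.toLp_add]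
        refine MemLp.toLp_congr _ _ ?_
        filter_upwards [Lp.coeFn_add g g'] with x hx
        change (f x : ℂ) * (g + g' : Lp ℂ 2 μ) x = f x * g x + f x * g' x
        rw [hx, Pi.add_apply, mul_add]
      map_smul' := fun c g => by
        rw [RingHom.id_apply, ← MemLp.toLp_const_smul]
        refine MemLp.toLp_congr _ _ ?_
        filter_upwards [Lp.coeFn_smul c g] with x hx
        simp [hx, mul_left_comm] } C fun g => by
    refine Lp.norm_le_mul_norm_of_ae_le_mul ?_
    filter_upwards [(memLp_mul hf hC g).coeFn_toLp] with x hx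
    change ‖((memLp_mul hf hC g).toLp _ : Lp ℂ 2 μ) x‖ ≤ _
    rw [hx, norm_mul, Complex.norm_real]
    gcongr
    exact hC x

variable {f : Λ → ℝ} (hf : Measurable f) {C : ℝ} (hC : ∀ x, |f x| ≤ C)

theorem mulOperator_apply (g : Lp ℂ 2 μ) :
    mulOperator μ hf hC g =ᵐ[μ] fun x => (f x : ℂ) * g x :=
  (memLp_mul hf hC g).coeFn_toLp

theorem norm_mulOperator_le (hC0 : 0 ≤ C) : ‖mulOperator μ hf hC‖ ≤ C :=
  LinearMap.mkContinuous_norm_le _ hC0 _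

theorem isSelfAdjoint_mulOperator : IsSelfAdjoint (mulOperator μ hf hC) := by
  rw [ContinuousLinearMap.isSelfAdjoint_iff_isSymmetric]
  intro g g'
  change ⟪mulOperator μ hf hC g, g'⟫_ℂ = ⟪g, mulOperator μ hf hC g'⟫_ℂ
  rw [L2.inner_def, L2.inner_def]
  refine integral_congr_ae ?_
  filter_upwards [mulOperator_apply (μ := μ) hf hC g, mulOperator_apply (μ := μ) hf hC g']
    with x hx hx'
  simp only [hx, hx', RCLike.inner_apply, map_mul, Complex.conj_ofReal]
  ring

theorem mulOperator_pow_apply (n : ℕ) (g : Lp ℂ 2 μ) :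
    (mulOperator μ hf hC ^ n) g =ᵐ[μ] fun x => (f x : ℂ) ^ n * g x := by
  induction n with
  | zero => exact Eventually.of_forall fun x => by simp
  | succ n ih =>
    rw [pow_succ']
    filter_upwards [ih, mulOperator_apply (μ := μ) hf hC ((mulOperator μ hf hC ^ n) g)] with x h1 h2
    rw [mul_apply_eq_comp, h2, h1, pow_succ']
    ring

/-- The exponential of multiplication by `f` is multiplication by `e^{tf}`, checked weakly by
integrating the power series term by term. -/
theorem inner_exp_mulOperator (t : ℂ) (g g' : Lp ℂ 2 μ) :
    ⟪g, NormedSpace.exp (t • mulOperator μ hf hC) g'⟫_ℂ =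
      ∫ x, Complex.exp (t * f x) * (g' x * starRingEnd ℂ (g x)) ∂μ := by
  have hi : Integrable (fun x => g' x * starRingEnd ℂ (g x)) μ := by
    simpa [RCLike.inner_apply] using L2.integrable_inner (𝕜 := ℂ) g g'
  set h := mulOperator μ hf hC with hh
  have h1 := ((NormedSpace.exp_series_hasSum_exp' (𝕂 := ℂ) (t • h)).mapL
    ((innerSL ℂ g).comp (ContinuousLinearMap.apply ℂ _ g')))
  have hmeas : ∀ n : ℕ, AEStronglyMeasurable
      (fun x => ((n.factorial : ℂ)⁻¹ * (t * f x) ^ n)) μ := fun n => by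
    have : Measurable fun x => (f x : ℂ) := Complex.measurable_ofReal.comp hf
    exact (((this.const_mul t).pow_const n).const_mul _).aestronglyMeasurable
  have hb : ∀ n x, ‖((n.factorial : ℂ)⁻¹ * (t * f x) ^ n)‖ ≤
      (n.factorial : ℝ)⁻¹ * (‖t‖ * C) ^ n := fun n x => by
    rw [norm_mul, norm_inv, norm_pow, norm_mul, Complex.norm_natCast, Complex.norm_real]
    gcongr
    exact hC x
  have hF : ∀ n : ℕ, Integrable
      (fun x => ((n.factorial : ℂ)⁻¹ * (t * f x) ^ n) * (g' x * starRingEnd ℂ (g x))) μ := fun n =>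
    hi.bdd_mul (hmeas n) (Eventually.of_forall (hb n))
  have hsum : Summable fun n : ℕ =>
      ∫ x, ‖((n.factorial : ℂ)⁻¹ * (t * f x) ^ n) * (g' x * starRingEnd ℂ (g x))‖ ∂μ := by
    have h2 := (NormedSpace.exp_series_hasSum_exp' (𝕂 := ℝ) (‖t‖ * C)).summable.mul_right
      (∫ x, ‖g' x * starRingEnd ℂ (g x)‖ ∂μ)
    refine Summable.of_nonneg_of_le (fun n => integral_nonneg fun _ => norm_nonneg _)
      (fun n => ?_) h2
    rw [smul_eq_mul, ← integral_const_mul]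
    refine integral_mono (hF n).norm (hi.norm.const_mul _) fun x => ?_
    simp only []
    rw [norm_mul]
    gcongr
    exact hb n x
  have h3 := hasSum_integral_of_summable_integral_norm hF hsum
  have h4 : ∀ n : ℕ, ((innerSL ℂ g).comp (ContinuousLinearMap.apply ℂ _ g'))
      ((n.factorial : ℂ)⁻¹ • (t • h) ^ n) =
      ∫ x, ((n.factorial : ℂ)⁻¹ * (t * f x) ^ n) * (g' x * starRingEnd ℂ (g x)) ∂μ := by
    intro n
    have h5 : ((innerSL ℂ g).comp (ContinuousLinearMap.apply ℂ _ g'))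
        ((n.factorial : ℂ)⁻¹ • (t • h) ^ n) =
        (n.factorial : ℂ)⁻¹ * (t ^ n * ⟪g, (h ^ n) g'⟫_ℂ) := by
      rw [smul_pow, map_smul, map_smul]; simp
    rw [h5, L2.inner_def, ← integral_const_mul, ← integral_const_mul]
    refine integral_congr_ae ?_
    filter_upwards [mulOperator_pow_apply (μ := μ) hf hC n g'] with x hx
    rw [hx, RCLike.inner_apply]
    ring
  simp_rw [h4] at h1
  refine Eq.trans ?_ ((h1.unique h3).trans ?_)
  · simp
  · refine integral_congr_ae (Eventually.of_forall fun x => ?_)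
    simp only []
    rw [tsum_mul_right, Complex.exp_eq_exp_ℂ, NormedSpace.exp_eq_tsum ℂ]
    simp [smul_eq_mul]

end MulOperator

/-! ### Correlation functions of a projection kernel. -/

section Correlation

variable {Λ : Type*} {N : ℕ} {K : Λ → Λ → ℂ} {ψ : Fin N → Λ → ℂ}

theorem of_kernel_eq_mul (hKψ : ∀ x z, K x z = ∑ j, ψ j x * starRingEnd ℂ (ψ j z)) {k : ℕ}
    (x : Fin k → Λ) : (Matrix.of fun i j => K (x i) (x j)) =
      (Matrix.of fun i l => ψ l (x i)) * (Matrix.of fun l i => starRingEnd ℂ (ψ l (x i))) := by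
  ext i j
  simp [Matrix.mul_apply, hKψ]

theorem det_kernel_eq_normSq (hKψ : ∀ x z, K x z = ∑ j, ψ j x * starRingEnd ℂ (ψ j z))
    (x : Fin N → Λ) : (Matrix.of fun i j => K (x i) (x j)).det =
      (Complex.normSq (Matrix.of fun i l => ψ l (x i)).det : ℂ) := by
  have h1 : (Matrix.of fun l i => starRingEnd ℂ (ψ l (x i))) =
      (Matrix.of fun i l => ψ l (x i)).conjTranspose := by
    ext; simp [Matrix.conjTranspose_apply]
  rw [of_kernel_eq_mul hKψ, h1, Matrix.det_mul, Matrix.det_conjTranspose, Complex.normSq_eq_conj_mul_self,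
    mul_comm]
  rfl

variable [MeasurableSpace Λ] {μ : Measure Λ} [SigmaFinite μ]

/-- The `N`-point correlation function of a projection kernel of rank `N`, tested on a product. -/
theorem lintegral_prod_correlation (hKψ : ∀ x z, K x z = ∑ j, ψ j x * starRingEnd ℂ (ψ j z))
    {W : Λ → ℝ} (hW0 : ∀ x, 0 ≤ W x)
    (hint : ∀ i j, Integrable (fun x => (W x : ℂ) * (ψ i x * starRingEnd ℂ (ψ j x))) μ) :
    ∃ r : ℝ, 0 ≤ r ∧
      (r : ℂ) = (Matrix.of fun i j => ∫ x, (W x : ℂ) * (ψ j x * starRingEnd ℂ (ψ i x)) ∂μ).det ∧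
      ∫⁻ x : Fin N → Λ, (∏ i, ENNReal.ofReal (W (x i))) *
        ENNReal.ofReal (Matrix.of fun i j => K (x i) (x j)).det.re ∂(Measure.pi fun _ => μ) =
      N.factorial * ENNReal.ofReal r := by
  obtain ⟨hi, he⟩ := andreief (χ := fun j x => starRingEnd ℂ (ψ j x)) hint
  -- The correlation determinant is `|det ψ_l(x_i)|²`, hence real and nonnegative, so the lower
  -- integral is a Bochner integral and Andréief applies.
  set F : (Fin N → Λ) → ℝ := fun x =>
    (∏ i, W (x i)) * Complex.normSq (Matrix.of fun i l => ψ l (x i)).det with hF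
  have hF0 : ∀ x, 0 ≤ F x := fun x =>
    mul_nonneg (Finset.prod_nonneg fun i _ => hW0 _) (Complex.normSq_nonneg _)
  have hFe : (fun x : Fin N → Λ => (∏ i, (W (x i) : ℂ)) *
      (Matrix.of fun i j => ∑ k, ψ k (x i) * starRingEnd ℂ (ψ k (x j))).det) =
      fun x => ((F x : ℝ) : ℂ) := by
    ext x
    simp_rw [← hKψ]
    rw [det_kernel_eq_normSq hKψ, hF]
    push_cast
    rfl
  rw [hFe] at hi he
  rw [integral_complex_ofReal] at he
  have hiF : Integrable F (Measure.pi fun _ => μ) := by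
    simpa using hi.re
  have hN : (N.factorial : ℝ) ≠ 0 := by positivity
  refine ⟨(∫ x, F x ∂(Measure.pi fun _ => μ)) / N.factorial,
    div_nonneg (integral_nonneg hF0) (by positivity), ?_, ?_⟩
  · rw [← Matrix.det_transpose]
    push_cast
    rw [he, mul_div_cancel_left₀ _ (by exact_mod_cast hN)]
    rfl
  · rw [ENNReal.ofReal_div_of_pos (by positivity), ENNReal.ofReal_natCast,
      ENNReal.mul_div_cancel (by positivity) (by simp),
      ofReal_integral_eq_lintegral_ofReal hiF (Eventually.of_forall hF0)]
    refine lintegral_congr fun x => ?_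
    rw [det_kernel_eq_normSq hKψ, Complex.ofReal_re, hF,
      ENNReal.ofReal_mul (Finset.prod_nonneg fun i _ => hW0 _),
      ENNReal.ofReal_prod_of_nonneg fun i _ => hW0 _]

end Correlation

/-! ### Counting tuples of distinct points. -/

section Embedding

variable {Λ : Type*} {N : ℕ}

/-- An embedding of `Fin N` into an `N`-point set is a bijection, so all `N!` tuples give the same
product. -/
theorem tsum_embedding_prod {S : Set Λ} (hS : S.encard = N) (v : Λ → ℝ≥0∞) :
    ∑' x : Fin N ↪ S, ∏ i, v (x i) = N.factorial * ∏ᶠ s ∈ S, v s := by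
  classical
  have hfin : S.Finite := Set.finite_of_encard_eq_coe hS
  have := hfin.fintype
  have hcard : Fintype.card S = N := by
    have := Set.coe_fintypeCard S
    rw [hS] at this
    exact_mod_cast this
  have h1 : ∀ x : Fin N ↪ S, ∏ i, v (x i) = ∏ᶠ s ∈ S, v s := by
    intro x
    have hb : Function.Bijective x :=
      (Fintype.bijective_iff_injective_and_card x).2 ⟨x.injective, by simp [hcard]⟩
    rw [hb.prod_comp (fun s : S => v s), ← finprod_eq_prod_of_fintype,
      finprod_set_coe_eq_finprod_mem (f := v) S]
  simp_rw [h1, tsum_fintype, Finset.sum_const, Finset.card_univ, Fintype.card_embedding_eq, hcard,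
    Fintype.card_fin, Nat.descFactorial_self, nsmul_eq_mul]

theorem nonempty_embedding_of_le_encard {S : Set Λ} (hS : (N : ℕ∞) ≤ S.encard) :
    Nonempty (Fin N ↪ S) := by
  obtain ⟨t, ht, hN⟩ := Set.exists_subset_encard_eq hS
  have hfin : t.Finite := Set.finite_of_encard_eq_coe hN
  have := hfin.fintype
  have hcard : Fintype.card t = N := by
    have := Set.coe_fintypeCard t
    rw [hN] at this
    exact_mod_cast this
  exact ⟨((Fintype.equivFinOfCardEq hcard).symm.toEmbedding).trans
    ⟨Set.inclusion ht, Set.inclusion_injective ht⟩⟩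

theorem isEmpty_embedding_of_encard_lt {S : Set Λ} (hS : S.encard < N) :
    IsEmpty (Fin N ↪ S) := by
  refine ⟨fun x => ?_⟩
  have hfin : S.Finite := Set.encard_lt_top_iff.1 (lt_of_lt_of_le hS le_top)
  have := hfin.fintype
  have h1 := Fintype.card_le_of_embedding x
  rw [← Set.coe_fintypeCard S] at hS
  rw [Fintype.card_fin] at h1
  exact absurd hS (not_lt.2 (by exact_mod_cast h1))

theorem linearStatistic_of_finite {S : Set Λ} (hS : S.Finite) (f : Λ → ℝ) :
    ∑' x : S, f x = ∑ x ∈ hS.toFinset, f x := by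
  have := hS.fintype
  rw [tsum_fintype, ← Finset.sum_coe_sort hS.toFinset]
  exact Fintype.sum_equiv (Equiv.subtypeEquivRight fun x => by simp) _ _ fun _ => rfl

variable {Ω : Type*} {ξ : Ω → Set Λ}

theorem abs_linearStatistic_le {ω : Ω} (hω : (ξ ω).encard = N) {f : Λ → ℝ} {C : ℝ}
    (hC : ∀ x, |f x| ≤ C) : |linearStatistic ξ f ω| ≤ N * C := by
  have hfin : (ξ ω).Finite := Set.finite_of_encard_eq_coe hω
  rw [linearStatistic, linearStatistic_of_finite hfin]
  refine (Finset.abs_sum_le_sum_abs _ _).trans ((Finset.sum_le_card_nsmul _ _ C fun x _ =>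
    hC x).trans (le_of_eq ?_))
  rw [hfin.encard_eq_coe_toFinset_card] at hω
  rw [nsmul_eq_mul]
  congr 2
  exact_mod_cast hω

end Embedding

/-! ### Measurability of linear statistics. -/

section Measurability

variable {Λ Ω : Type*} [MeasurableSpace Λ] [MeasurableSpace Ω] [TopologicalSpace Λ]
  {P : Measure Ω} {ξ : Ω → Set Λ}

/-- For simple `f` the statistic is a finite combination of counting variables; in general it is an
almost sure limit of such, since the sum is finite. -/
theorem aemeasurable_linearStatistic (hξ : IsPointProcess ξ) (hfin : ∀ᵐ ω ∂P, (ξ ω).Finite)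
    {f : Λ → ℝ} (hf : Measurable f) : AEMeasurable (linearStatistic ξ f) P := by
  classical
  have hsimple : ∀ g : SimpleFunc Λ ℝ, AEMeasurable (linearStatistic ξ g) P := by
    intro g
    have h1 : Measurable fun ω => ∑ c ∈ g.range, (((ξ ω ∩ g ⁻¹' {c}).encard.toNat : ℕ) : ℝ) * c :=
      Finset.measurable_fun_sum _ fun c _ => Measurable.mul_const
        ((measurable_from_top (f := fun n : ℕ∞ => ((n.toNat : ℕ) : ℝ))).comp
          (hξ.measurable_count _ (g.measurableSet_fiber c))) c
    refine h1.aemeasurable.congr ?_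
    filter_upwards [hfin] with ω hω
    rw [linearStatistic, linearStatistic_of_finite hω]
    have h2 : ∀ c, (ξ ω ∩ g ⁻¹' {c}).encard.toNat = (hω.toFinset.filter fun x => g x = c).card := by
      intro c
      have : ξ ω ∩ g ⁻¹' {c} = ((hω.toFinset.filter fun x => g x = c : Finset Λ) : Set Λ) := by
        ext x; simp
      rw [this, Set.encard_coe_eq_coe_finsetCard, ENat.toNat_natCast]
    simp_rw [h2]
    rw [← Finset.sum_fiberwise_of_maps_to (s := hω.toFinset) (t := g.range) (g := g)
      (fun x _ => g.mem_range_self x)]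
    refine Finset.sum_congr rfl fun c _ => ?_
    rw [Finset.sum_congr rfl fun x hx => (Finset.mem_filter.1 hx).2, Finset.sum_const, nsmul_eq_mul]
  refine aemeasurable_of_tendsto_metrizable_ae atTop
    (fun n => hsimple (hf.stronglyMeasurable.approx n)) ?_
  filter_upwards [hfin] with ω hω
  simp only [linearStatistic, linearStatistic_of_finite hω]
  exact tendsto_finsetSum _ fun x _ => hf.stronglyMeasurable.tendsto_approx x

end Measurability

/-! ### The number of points and the exponential moments. -/

section NumberOfPoints

variable {Λ Ω : Type*} [MeasurableSpace Λ] [MeasurableSpace Ω] [TopologicalSpace Λ]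
  {P : Measure Ω} {ξ : Ω → Set Λ} {μ : Measure Λ} {N : ℕ}
  {K : Λ → Λ → ℂ} {ψ : Fin N → Λ → ℂ}

theorem measurable_encard (hξ : IsPointProcess ξ) : Measurable fun ω => (ξ ω).encard := by
  simpa using hξ.measurable_count Set.univ MeasurableSet.univ

/-- The `(N + 1)`-point correlation vanishes because the kernel has rank at most `N`, so the
expected number of `(N + 1)`-tuples is zero. -/
theorem ae_encard_le (hξ : IsDeterminantal P ξ μ K)
    (hKψ : ∀ x z, K x z = ∑ j, ψ j x * starRingEnd ℂ (ψ j z)) :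
    ∀ᵐ ω ∂P, (ξ ω).encard ≤ N := by
  have h1 := hξ.correlation (N + 1) (fun _ => 1) measurable_const
  have h2 : ∀ x : Fin (N + 1) → Λ, (Matrix.of fun i j => K (x i) (x j)).det = 0 := fun x => by
    rw [of_kernel_eq_mul hKψ, det_eq_zero_of_lt (Nat.lt_succ_self N)]
  simp only [h2, Complex.zero_re, ENNReal.ofReal_zero, mul_zero, lintegral_zero] at h1
  have hm : MeasurableSet {ω | ((N + 1 : ℕ) : ℕ∞) ≤ (ξ ω).encard} :=
    measurable_encard hξ.toIsPointProcess (MeasurableSet.of_discrete (s := Set.Ici ((N + 1 : ℕ) : ℕ∞)))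
  have h3 : P {ω | ((N + 1 : ℕ) : ℕ∞) ≤ (ξ ω).encard} = 0 := by
    refine le_antisymm ?_ zero_le
    rw [← h1, ← lintegral_indicator_one hm]
    refine lintegral_mono fun ω => ?_
    refine Set.indicator_le' (fun ω hω => ?_) (fun ω _ => (zero_le : (0 : ℝ≥0∞) ≤ ∑' _ : Fin (N + 1) ↪ ξ ω, 1)) ω
    obtain ⟨x⟩ := nonempty_embedding_of_le_encard hω
    exact ENNReal.le_tsum x
  rw [← compl_compl {ω | ((N + 1 : ℕ) : ℕ∞) ≤ (ξ ω).encard}] at h3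
  filter_upwards [mem_ae_iff.2 h3] with ω hω
  by_contra hc
  refine hω ?_
  rw [not_le] at hc
  exact_mod_cast Order.add_one_le_of_lt hc

variable [SigmaFinite μ]

/-- The exponential moments of a linear statistic as determinants. -/
theorem mgf_linearStatistic (hξ : IsDeterminantal P ξ μ K)
    (hKψ : ∀ x z, K x z = ∑ j, ψ j x * starRingEnd ℂ (ψ j z))
    (hcard : ∀ᵐ ω ∂P, (ξ ω).encard = N) {f : Λ → ℝ} (hf : Measurable f) (t : ℝ)
    (hint : ∀ i j, Integrable
      (fun x => ((Real.exp (t * f x) : ℝ) : ℂ) * (ψ i x * starRingEnd ℂ (ψ j x))) μ) :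
    ((mgf (linearStatistic ξ f) P t : ℝ) : ℂ) = (Matrix.of fun i j =>
      ∫ x, ((Real.exp (t * f x) : ℝ) : ℂ) * (ψ j x * starRingEnd ℂ (ψ i x)) ∂μ).det := by
  obtain ⟨r, hr0, hr, he⟩ := lintegral_prod_correlation (μ := μ)
    (W := fun x => Real.exp (t * f x)) hKψ (fun _ => (Real.exp_pos _).le) hint
  rw [← hr]
  congr 1
  have hfin : ∀ᵐ ω ∂P, (ξ ω).Finite := by
    filter_upwards [hcard] with ω hω using Set.finite_of_encard_eq_coe hω
  have hX := aemeasurable_linearStatistic hξ.toIsPointProcess hfin hf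
  -- With exactly `N` points, each of the `N!` ordered tuples contributes `exp(t X_f)` to this test
  -- function.
  have h1 := hξ.correlation N (fun y => ∏ i, ENNReal.ofReal (Real.exp (t * f (y i))))
    (Finset.measurable_fun_prod _ fun i _ => by fun_prop)
  rw [he] at h1
  have h2 : ∫⁻ ω, ∑' x : Fin N ↪ ξ ω, ∏ i, ENNReal.ofReal (Real.exp (t * f (x i))) ∂P =
      N.factorial * ∫⁻ ω, ENNReal.ofReal (Real.exp (t * linearStatistic ξ f ω)) ∂P := by
    rw [← lintegral_const_mul' _ _ (by simp)]
    refine lintegral_congr_ae ?_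
    filter_upwards [hcard, hfin] with ω hω hω'
    rw [tsum_embedding_prod hω fun y => ENNReal.ofReal (Real.exp (t * f y)),
      finprod_mem_eq_finite_toFinset_prod _ hω', linearStatistic, linearStatistic_of_finite hω',
      Finset.mul_sum, Real.exp_sum, ENNReal.ofReal_prod_of_nonneg fun _ _ => (Real.exp_pos _).le]
  rw [h2] at h1
  have h4 : (N.factorial : ℝ≥0∞) ≠ 0 := by positivity
  have h5 := (ENNReal.mul_right_inj h4 (by simp)).1 h1
  rw [mgf, integral_eq_lintegral_of_nonneg_ae (Eventually.of_forall fun _ => (Real.exp_pos _).le)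
    (hX.const_mul t).exp.aestronglyMeasurable, h5, ENNReal.toReal_ofReal hr0]

variable [IsProbabilityMeasure P]

/-- The expected number of ordered `N`-tuples is `N!` times a Gram determinant equal to `1`. With at
most `N` points there are either `N!` such tuples or none, so the former has probability one. -/
theorem ae_encard_eq (hξ : IsDeterminantal P ξ μ K)
    (hKψ : ∀ x z, K x z = ∑ j, ψ j x * starRingEnd ℂ (ψ j z))
    (hint : ∀ i j, Integrable (fun x => ψ i x * starRingEnd ℂ (ψ j x)) μ)
    (horth : ∀ i j, ∫ x, ψ j x * starRingEnd ℂ (ψ i x) ∂μ = if i = j then 1 else 0) :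
    ∀ᵐ ω ∂P, (ξ ω).encard = N := by
  obtain ⟨r, hr0, hr, he⟩ := lintegral_prod_correlation (μ := μ) (W := fun _ => 1) hKψ
    (fun _ => zero_le_one) (by simpa using hint)
  have hr1 : r = 1 := by
    have h1 : (Matrix.of fun i j : Fin N => ∫ x, ((1 : ℝ) : ℂ) * (ψ j x * starRingEnd ℂ (ψ i x)) ∂μ)
        = 1 := by
      ext i j
      simp [horth, Matrix.one_apply]
    rw [h1, Matrix.det_one] at hr
    exact_mod_cast hr
  have h1 := hξ.correlation N (fun _ => 1) measurable_const
  simp only [ENNReal.ofReal_one, Finset.prod_const_one, hr1, mul_one] at he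
  rw [he] at h1
  set A : Set Ω := {ω | (ξ ω).encard = N} with hA
  have hAm : MeasurableSet A :=
    measurable_encard hξ.toIsPointProcess (measurableSet_singleton (N : ℕ∞))
  have h2 : ∫⁻ ω, ∑' _ : Fin N ↪ ξ ω, 1 ∂P = N.factorial * P A := by
    rw [← lintegral_indicator_const hAm]
    refine lintegral_congr_ae ?_
    filter_upwards [ae_encard_le hξ hKψ] with ω hω
    by_cases hωA : ω ∈ A
    · rw [Set.indicator_of_mem hωA]
      simpa using tsum_embedding_prod hωA fun _ => 1
    · rw [Set.indicator_of_notMem hωA]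
      have := isEmpty_embedding_of_encard_lt (lt_of_le_of_ne hω hωA)
      exact tsum_empty
  rw [h2] at h1
  have h3 : P A = 1 := by
    have h4 : (N.factorial : ℝ≥0∞) ≠ 0 := by positivity
    exact (ENNReal.mul_right_inj h4 (by simp)).1 (h1.trans (mul_one _).symm)
  exact (mem_ae_iff_prob_eq_one hAm).2 h3

end NumberOfPoints

/-! ### Chernoff's bound. -/

section Chernoff

variable {Ω : Type*} [MeasurableSpace Ω] {P : Measure Ω} [IsProbabilityMeasure P]

/-- The two-sided Chernoff bound for a random variable with a quadratic bound for its cumulant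
generating function in a neighbourhood of `0`. -/
theorem chernoff_two_sided {X : Ω → ℝ} (hexp : ∀ t : ℝ, Integrable (fun ω => Real.exp (t * X ω)) P)
    {m V A b : ℝ} (hA : 0 < A) (hV : 0 ≤ V) (hb : 0 ≤ b)
    (hc : ∀ t : ℝ, 3 * b * |t| ≤ 1 → |cgf X P t - t * m| ≤ A * t ^ 2 * V) {ε : ℝ} (hε : 0 < ε) :
    (ε < 2 * A * V / (3 * b) →
      P.real {ω | ε ≤ |X ω - m|} ≤ 2 * Real.exp (-(ε ^ 2 / (4 * A * V)))) ∧
    (2 * A * V / (3 * b) ≤ ε →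
      P.real {ω | ε ≤ |X ω - m|} ≤ 2 * Real.exp (-(ε / (6 * b)))) := by
  have key : ∀ t : ℝ, 0 ≤ t → 3 * b * t ≤ 1 →
      P.real {ω | ε ≤ |X ω - m|} ≤ 2 * Real.exp (-t * ε + A * t ^ 2 * V) := by
    intro t ht hbt
    have h1 := measure_ge_le_exp_cgf (μ := P) (X := X) (m + ε) ht (hexp t)
    have h2 := measure_le_le_exp_cgf (μ := P) (X := X) (m - ε) (neg_nonpos.2 ht) (hexp (-t))
    have h3 := (abs_le.1 (hc t (by rwa [abs_of_nonneg ht]))).2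
    have h4 := (abs_le.1 (hc (-t) (by rwa [abs_neg, abs_of_nonneg ht]))).2
    have hsub : {ω | ε ≤ |X ω - m|} ⊆ {ω | m + ε ≤ X ω} ∪ {ω | X ω ≤ m - ε} := by
      intro ω hω
      rcases le_abs.1 (show ε ≤ |X ω - m| from hω) with h | h
      · left; change m + ε ≤ X ω; linarith
      · right; change X ω ≤ m - ε; linarith
    calc P.real {ω | ε ≤ |X ω - m|}
        ≤ P.real {ω | m + ε ≤ X ω} + P.real {ω | X ω ≤ m - ε} :=
          (measureReal_mono hsub).trans (measureReal_union_le _ _)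
      _ ≤ Real.exp (-t * ε + A * t ^ 2 * V) + Real.exp (-t * ε + A * t ^ 2 * V) := by
          refine add_le_add (h1.trans (Real.exp_le_exp.2 ?_)) (h2.trans (Real.exp_le_exp.2 ?_))
          · linarith
          · rw [neg_sq] at h4; linarith
      _ = _ := by ring
  constructor
  · intro h
    have hb0 : 0 < b := by
      rcases hb.eq_or_lt with h0 | h0
      · rw [← h0] at h; simp at h; linarith
      · exact h0
    rw [lt_div_iff₀ (by positivity)] at h
    have hV0 : 0 < V := by
      rcases hV.eq_or_lt with h0 | h0
      · rw [← h0] at h; have : 0 < ε * (3 * b) := by positivity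
        linarith
      · exact h0
    -- The minimiser of `-tε + At²V`; it is admissible exactly when `3bε ≤ 2AV`.
    refine (key (ε / (2 * A * V)) (by positivity) ?_).trans (le_of_eq ?_)
    · rw [← mul_div_assoc, div_le_one (by positivity)]; linarith
    · congr 2
      field_simp
      ring
  · intro h
    rcases hb.eq_or_lt with h0 | hb0
    -- For `b = 0` division by zero makes the right side `2 exp 0 = 2`.
    · rw [← h0]
      simp only [mul_zero, div_zero, neg_zero, Real.exp_zero, mul_one]
      exact measureReal_le_one.trans one_le_two
    · rw [div_le_iff₀ (by positivity)] at h
      -- The minimiser is not inside the admissible interval, so the endpoint is used; there the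
      -- quadratic term is at most half of `ε/(3b)`.
      refine (key (1 / (3 * b)) (by positivity) (le_of_eq (by field_simp))).trans ?_
      gcongr
      have h5 : -(1 / (3 * b)) * ε + A * (1 / (3 * b)) ^ 2 * V =
          -(ε / (6 * b)) - (ε * (3 * b) - 2 * A * V) / (18 * b ^ 2) := by
        field_simp
        ring
      rw [h5]
      have : 0 ≤ (ε * (3 * b) - 2 * A * V) / (18 * b ^ 2) :=
        div_nonneg (by linarith) (by positivity)
      linarith

end Chernoff

/-! ### Cumulant bound for linear statistics. -/

section Concentration

theorem abs_le_supNorm {Λ : Type*} {f : Λ → ℝ} (hb : ∃ C, ∀ x, |f x| ≤ C) (x : Λ) : |f x| ≤ supNorm f := by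
  obtain ⟨C, hC⟩ := hb
  exact le_ciSup (f := fun x => |f x|) ⟨C, by rintro _ ⟨y, rfl⟩; exact hC y⟩ x

variable {Λ Ω : Type*} [TopologicalSpace Λ] [MeasurableSpace Λ]
  [MeasurableSpace.CountablyGenerated Λ] [MeasurableSpace Ω] {μ : Measure Λ} [SigmaFinite μ]
  {K : Λ → Λ → ℂ} {P : Measure Ω} [IsProbabilityMeasure P] {ξ : Ω → Set Λ}

/-- The number of points is almost surely `N`, so the statistic is bounded and all exponential
moments exist. Its moment generating function is the determinant treated in
`cumulant_of_exp_eq_det`, whose first two derivatives at `0` are identified with mean and variance.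
-/
theorem linearStatistic_concentration (hK : IsFiniteRankProjectionKernel μ K)
    (hξ : IsDeterminantal P ξ μ K) {f : Λ → ℝ} (hf : Measurable f) (hb : ∃ C, ∀ x, |f x| ≤ C) :
    (∀ᵐ ω ∂P, (ξ ω).Finite) ∧ MemLp (linearStatistic ξ f) 2 P ∧
      (∀ t : ℝ, Integrable (fun ω => Real.exp (t * linearStatistic ξ f ω)) P) ∧
      ∀ t : ℝ, 3 * supNorm f * |t| ≤ 1 →
        |cgf (linearStatistic ξ f) P t - t * P[linearStatistic ξ f]| ≤
          12 * t ^ 2 * Var[linearStatistic ξ f; P] := by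
  obtain ⟨T, N, φ, ψ, hT, hφ, hTφ, hψ, hKψ⟩ := exists_spectral_representation hK
  have hC := abs_le_supNorm hb
  set b := supNorm f with hbdef
  have hb0 : 0 ≤ b := Real.iSup_nonneg fun x => abs_nonneg _
  have hψφ : ∀ i j, (fun x => ψ i x * starRingEnd ℂ (ψ j x)) =ᵐ[μ] fun x => ⟪φ j x, φ i x⟫_ℂ := by
    intro i j
    filter_upwards [hψ i, hψ j] with x h1 h2
    rw [h1, h2, RCLike.inner_apply]
  have hint : ∀ i j, Integrable (fun x => ψ i x * starRingEnd ℂ (ψ j x)) μ := fun i j =>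
    (L2.integrable_inner (𝕜 := ℂ) (φ j) (φ i)).congr (hψφ i j).symm
  have horth : ∀ i j, ∫ x, ψ j x * starRingEnd ℂ (ψ i x) ∂μ = if i = j then 1 else 0 := by
    intro i j
    rw [integral_congr_ae (hψφ j i), ← L2.inner_def, orthonormal_iff_ite.1 hφ]
  have hcard := ae_encard_eq hξ hKψ hint horth
  have hfin : ∀ᵐ ω ∂P, (ξ ω).Finite := by
    filter_upwards [hcard] with ω hω using Set.finite_of_encard_eq_coe hω
  have hX := aemeasurable_linearStatistic hξ.toIsPointProcess hfin hf
  set X := linearStatistic ξ f with hXdef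
  have hXb : ∀ᵐ ω ∂P, |X ω| ≤ N * b := by
    filter_upwards [hcard] with ω hω using abs_linearStatistic_le hω hC
  have hexp : ∀ t : ℝ, Integrable (fun ω => Real.exp (t * X ω)) P := by
    intro t
    refine Integrable.of_bound (hX.const_mul t).exp.aestronglyMeasurable
      (Real.exp (|t| * (N * b))) ?_
    filter_upwards [hXb] with ω hω
    rw [Real.norm_of_nonneg (Real.exp_pos _).le]
    refine Real.exp_le_exp.2 ((le_abs_self _).trans ?_)
    rw [abs_mul]
    gcongr
  refine ⟨hfin, MemLp.of_bound hX.aestronglyMeasurable (N * b) hXb, hexp, ?_⟩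
  have hexpint : ∀ (t : ℝ) i j, Integrable
      (fun x => ((Real.exp (t * f x) : ℝ) : ℂ) * (ψ i x * starRingEnd ℂ (ψ j x))) μ := by
    intro t i j
    refine (hint i j).bdd_mul (c := Real.exp (|t| * b)) ?_ (Eventually.of_forall fun x => ?_)
    · exact (Complex.measurable_ofReal.comp (hf.const_mul t).exp).aestronglyMeasurable
    · rw [Complex.norm_real, Real.norm_of_nonneg (Real.exp_pos _).le]
      refine Real.exp_le_exp.2 ((le_abs_self _).trans ?_)
      rw [abs_mul]
      gcongr
      exact hC x
  have hc : ∀ t : ℝ, ((Real.exp (cgf X P t) : ℝ) : ℂ) =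
      (Matrix.of fun i j =>
        ⟪φ i, NormedSpace.exp ((t : ℂ) • mulOperator μ hf hC) (φ j)⟫_ℂ).det := by
    intro t
    rw [exp_cgf (hexp t), mgf_linearStatistic hξ hKψ hcard hf t (hexpint t)]
    congr 1
    ext i j
    simp only [Matrix.of_apply]
    rw [inner_exp_mulOperator]
    refine integral_congr_ae ?_
    filter_upwards [hψ i, hψ j] with x h1 h2
    rw [h1, h2]
    push_cast
    rfl
  -- Needed for the instance that makes `L²` separable.
  have : Fact ((2 : ℝ≥0∞) ≠ ⊤) := ⟨by simp⟩
  obtain ⟨hvar, hbound⟩ := cumulant_of_exp_eq_det hφ hT hTφ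
    (isSelfAdjoint_mulOperator (μ := μ) hf hC) hc
  have hset : integrableExpSet X P = Set.univ := Set.eq_univ_of_forall hexp
  have h0 : (0 : ℝ) ∈ interior (integrableExpSet X P) := by simp [hset]
  have hmean : deriv (cgf X P) 0 = P[X] := by rw [deriv_cgf_zero h0]; simp
  have hVar : deriv (deriv (cgf X P)) 0 = Var[X; P] := by
    have h1 := iteratedDeriv_two_cgf_eq_integral h0
    rw [iteratedDeriv_succ, iteratedDeriv_one] at h1
    rw [h1, variance_eq_integral hX, hmean]
    simp
  intro t ht
  have h2 := hbound t (le_trans (by gcongr; exact norm_mulOperator_le hf hC hb0) ht)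
  rwa [← hvar, hVar, hmean] at h2

end Concentration

end DPP

theorem mainTheorem3 :
    ∃ A : ℝ, 0 < A ∧
      -- the concentration inequality for linear statistics of determinantal point processes
      (∀ (Λ : Type u) [TopologicalSpace Λ] [PolishSpace Λ] [LocallyCompactSpace Λ]
          [MeasurableSpace Λ] [BorelSpace Λ] (μ : Measure Λ) [IsLocallyFiniteMeasure μ]
          (K : Λ → Λ → ℂ), DPP.IsFiniteRankProjectionKernel μ K →
        ∀ (Ω : Type v) [MeasurableSpace Ω] (P : Measure Ω) [IsProbabilityMeasure P]
          (ξ : Ω → Set Λ), DPP.IsDeterminantal P ξ μ K →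
        ∀ f : Λ → ℝ, Measurable f → (∃ C, ∀ x, |f x| ≤ C) →
          (∀ᵐ ω ∂P, (ξ ω).Finite) ∧
          MemLp (DPP.linearStatistic ξ f) 2 P ∧
          ∀ ε : ℝ, 0 < ε →
            (ε < 2 * A * Var[DPP.linearStatistic ξ f; P] / (3 * DPP.supNorm f) →
              P.real {ω | ε ≤ |DPP.linearStatistic ξ f ω - P[DPP.linearStatistic ξ f]|} ≤
                2 * Real.exp (-(ε ^ 2 / (4 * A * Var[DPP.linearStatistic ξ f; P])))) ∧
            (2 * A * Var[DPP.linearStatistic ξ f; P] / (3 * DPP.supNorm f) ≤ ε →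
              P.real {ω | ε ≤ |DPP.linearStatistic ξ f ω - P[DPP.linearStatistic ξ f]|} ≤
                2 * Real.exp (-(ε / (6 * DPP.supNorm f))))) ∧
      -- the bound on `log det(1 + (e^{th} - 1)K)`, with the continuous branch of the logarithm
      -- that vanishes at `t = 0`
      (∀ (H : Type w) [NormedAddCommGroup H] [InnerProductSpace ℂ H] [CompleteSpace H]
          [TopologicalSpace.SeparableSpace H] (ι : Type z) (e : HilbertBasis ι ℂ H)
          (K h : H →L[ℂ] H), IsStarProjection K →
          DPP.IsTraceClass (h * K) → DPP.IsTraceClass (K * h) →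
        ∃ L : ℂ → ℂ, ContinuousOn L {t | 3 * ‖h‖ * ‖t‖ ≤ 1} ∧ L 0 = 0 ∧
          ∀ t : ℂ, 3 * ‖h‖ * ‖t‖ ≤ 1 →
            Complex.exp (L t) = DPP.fredholmDet e ((NormedSpace.exp (t • h) - 1) * K) ∧
            ‖L t - t * DPP.trace e (h * K)‖ ≤
              1 / 2 * A * ‖t‖ ^ 2 * DPP.hilbertSchmidtNorm e (h * K - K * h) ^ 2) := by
  -- Concentration uses `12 = 3 · 4`: the `3` of the determinant estimate times the `4` relating
  -- commutator norm to variance. The determinant bound alone needs only `A/2 ≥ 3`.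
  refine ⟨12, by norm_num, ?_, ?_⟩
  · intro Λ _ _ _ _ _ μ _ K hK Ω _ P _ ξ hξ f hf hb
    obtain ⟨hfin, hX, hexp, hc⟩ := DPP.linearStatistic_concentration hK hξ hf hb
    exact ⟨hfin, hX, fun ε hε => DPP.chernoff_two_sided hexp (by norm_num) (variance_nonneg _ _)
      (Real.iSup_nonneg fun x => abs_nonneg _) hc hε⟩
  · intro H _ _ _ _ ι e K h hK h1 h2
    obtain ⟨L, hL, hL0, hLt⟩ := DPP.exists_log_fredholmDet e hK h1 h2
    refine ⟨L, hL, hL0, fun t ht => ⟨(hLt t ht).1, (hLt t ht).2.trans ?_⟩⟩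
    gcongr
    norm_num
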